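/- **Path Murnaghan–Nakayama rule.** Symmetric functions are in infinitely many variables $x_1,x_2,\dots$ over $\mathbb{C}$; $p_d=\sum_i x_i^d$, $p_\nu=p_{\nu_1}p_{\nu_2}\cdots$, and $s_\lambda=\lim_{N\to\infty}\frac{\varepsilon\cdot x^{\lambda+\delta}}{\varepsilon\cdot x^{\delta}}$ is the Schur function, where $\delta=(N-1,\dots,1,0)$ and $\varepsilon=\sum_{w\in\mathfrak{S}_N}\mathrm{sign}(w)\,w$. A partial permutation $(I,J)$ of $[n]$ is a pair of sequences $I=(i_1,\dots,i_k)$, $J=(j_1,\dots,j_k)$ in $[n]$, each with distinct entries; its graph is the directed graph on $[n]$ with edges $i_1\to j_1,\dots,i_k\to j_k$. Its atomic symmetric function is $A_{n,I,J}=n!\cdot\mathrm{ch}_n(R\,\mathbf 1_{I,J})$, where $\mathbf 1_{I,J}(w)=1$ if $w(i_t)=j_t$ for all $t$ and $\mathbf 1_{I,J}(w)=0$ otherwise, $(Rf)(w)=\frac1{n!}\sum_{v\in\mathfrak S_n}f(v^{-1}wv)$, and $\mathrm{ch}_n(f)=\frac1{n!}\sum_{w\in\mathfrak S_n}f(w)\,p_{\mathrm{cyc}(w)}$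 with $\mathrm{cyc}(w)$ the cycle type of $w$. It depends only on the isomorphism class of the graph. For a partition $\mu=(\mu_1,\dots,\mu_r)$ of $n$, the path power sum $\vec p_\mu$ is $A_{n,I,J}$ for any $(I,J)$ whose graph is isomorphic to the disjoint union of directed paths with $\mu_1,\dots,\mu_r$ vertices. A ribbon $\xi$ is a nonempty edgewise connected skew shape containing no $2\times2$ square; $\mathrm{sign}(\xi)=(-1)^{h-1}$, where $h$ is the number of rows that $\xi$ occupies, and the tail of $\xi$ is its southwesternmost cell (Young diagrams are drawn in English notation). A monotonic ribbon tiling $T$ of a Young diagram $\lambda=\mathrm{shape}(T)$ is a decomposition $\lambda=\xi^{(1)}\sqcup\cdots\sqcup\xi^{(r)}$ into disjoint ribbons such that the tails of $\xi^{(1)},\dots,\xi^{(r)}$ lie in columns $c_1<\cdots<c_r$, and $\xi^{(1)}\sqcup\cdots\sqcup\xi^{(i)}$ is the Young diagram of a partition for every $0\le i\le r$. Put $\mathrm{sign}(T)=\prod_i\mathrm{sign}(\xi^{(i)})$ and $\mathrm{type}(T)=(|\xi^{(1)}|,\dots,|\xi^{(r)}|)$, and let $\mathrm{sort}(\mathrm{type}(T))$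 be its weakly decreasing rearrangement. **Theorem.** Let $n\ge0$, let $\mu$ be a partition of $n$, and let $m(\mu)!=\prod_{i\ge1}m_i(\mu)!$, where $m_i(\mu)$ is the number of parts of $\mu$ equal to $i$. Then $$\vec p_\mu \;=\; m(\mu)!\cdot\sum_T \mathrm{sign}(T)\cdot s_{\mathrm{shape}(T)},$$ where the sum is over all monotonic ribbon tilings $T$ with $\mathrm{sort}(\mathrm{type}(T))=\mu$. -/

import Mathlib

open scoped BigOperators Nat

namespace PathMN

noncomputable section

/-! ### Symmetric functions

Symmetric functions over `ℂ` in the variables `x 0, x 1, x 2, …` are regarded as elements of the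
ring `MvPowerSeries ℕ ℂ` of formal power series in infinitely many variables. -/

/-- The power sum `p_d = ∑ i, (x i) ^ d` (for `d > 0`). -/
def powerSum (d : ℕ) : MvPowerSeries ℕ ℂ :=
  open Classical in fun m => if ∃ i : ℕ, m = Finsupp.single i d then 1 else 0

/-- The power sum `p_ν = p_{ν₁} p_{ν₂} ⋯` of a partition `ν`. -/
def powerSumPart {n : ℕ} (ν : n.Partition) : MvPowerSeries ℕ ℂ :=
  (ν.parts.map powerSum).prod

/-- The alternant `ε · x ^ (β + δ)` in `N` variables, where `δ = (N - 1, …, 1, 0)` and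
`ε = ∑ w, sign w • w` acts by permuting the variables. -/
def alternant (N : ℕ) (β : Fin N → ℕ) : MvPolynomial (Fin N) ℂ :=
  ∑ w : Equiv.Perm (Fin N), (Equiv.Perm.sign w : ℤ) •
    MvPolynomial.rename w (∏ i : Fin N, MvPolynomial.X i ^ (β i + (N - 1 - (i : ℕ))))

theorem alternant_eq_det (N : ℕ) (β : Fin N → ℕ) :
    alternant N β = Matrix.det (Matrix.of fun i j : Fin N =>
      (MvPolynomial.X i : MvPolynomial (Fin N) ℂ) ^ (β j + (N - 1 - (j : ℕ)))) := by
  rw [Matrix.det_apply]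
  refine Finset.sum_congr rfl fun w _ => ?_
  simp [map_prod, Units.smul_def]

theorem alternant_zero_eq (N : ℕ) :
    alternant N 0 = ∏ i : Fin N, ∏ j ∈ Finset.Ioi i,
      ((MvPolynomial.X i : MvPolynomial (Fin N) ℂ) - MvPolynomial.X j) := by
  rw [alternant_eq_det]
  have h := Matrix.det_projVandermonde (R := MvPolynomial (Fin N) ℂ) (fun _ => 1)
    (fun i => MvPolynomial.X i)
  have e : (Matrix.of fun i j : Fin N => (MvPolynomial.X i : MvPolynomial (Fin N) ℂ) ^
      ((0 : Fin N → ℕ) j + (N - 1 - (j : ℕ)))) =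
      Matrix.projVandermonde (fun _ => 1) (fun i => MvPolynomial.X i) := by
    ext1 i j
    rw [Matrix.projVandermonde_apply]
    simp only [Matrix.of_apply, Pi.zero_apply, zero_add, one_pow, one_mul, Fin.val_rev]
    congr 1
    omega
  rw [e, h]
  simp

theorem alternant_zero_ne_zero (N : ℕ) : alternant N 0 ≠ 0 := by
  rw [alternant_zero_eq]
  refine Finset.prod_ne_zero_iff.2 fun i _ => Finset.prod_ne_zero_iff.2 fun j hj => ?_
  rw [sub_ne_zero]
  intro h
  exact (Finset.mem_Ioi.1 hj).ne (MvPolynomial.X_injective h)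

theorem X_sub_X_dvd {N : ℕ} {i j : Fin N} {f : MvPolynomial (Fin N) ℂ}
    (h : MvPolynomial.aeval (fun k => if k = j then (MvPolynomial.X i : MvPolynomial (Fin N) ℂ)
      else MvPolynomial.X k) f = 0) :
    (MvPolynomial.X i - MvPolynomial.X j : MvPolynomial (Fin N) ℂ) ∣ f := by
  have key : ∀ g : MvPolynomial (Fin N) ℂ,
      (MvPolynomial.X i - MvPolynomial.X j : MvPolynomial (Fin N) ℂ) ∣
        MvPolynomial.aeval (fun k => if k = j then (MvPolynomial.X i : MvPolynomial (Fin N) ℂ)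
          else MvPolynomial.X k) g - g := by
    intro g
    induction g using MvPolynomial.induction_on with
    | C a => simp
    | add p q hp hq =>
      rw [map_add, add_sub_add_comm]
      exact dvd_add hp hq
    | mul_X p k hp =>
      rw [map_mul, MvPolynomial.aeval_X]
      split_ifs with hk
      · subst hk
        obtain ⟨r, hr⟩ := hp
        refine ⟨r * MvPolynomial.X i + p, ?_⟩
        rw [sub_eq_iff_eq_add] at hr
        rw [hr]
        ring
      · rw [← sub_mul]
        exact hp.mul_right _
  have := key f
  rw [h, zero_sub] at this
  exact (dvd_neg).1 this

theorem irreducible_X_sub_X {N : ℕ} {i j : Fin N} (hij : i ≠ j) :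
    Irreducible (MvPolynomial.X i - MvPolynomial.X j : MvPolynomial (Fin N) ℂ) := by
  have hc : MvPolynomial.coeff (Finsupp.single i 1)
      (MvPolynomial.X i - MvPolynomial.X j : MvPolynomial (Fin N) ℂ) = 1 := by
    simp [MvPolynomial.coeff_X, Finsupp.single_left_inj, hij.symm]
  refine MvPolynomial.irreducible_of_totalDegree_eq_one (le_antisymm ?_ ?_) ?_
  · refine (MvPolynomial.totalDegree_sub _ _).trans ?_
    simp
  · have := MvPolynomial.le_totalDegree (p := (MvPolynomial.X i - MvPolynomial.X j :
      MvPolynomial (Fin N) ℂ)) (s := Finsupp.single i 1) (by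
        rw [MvPolynomial.mem_support_iff, hc]; exact one_ne_zero)
    simpa using this
  · intro x hx
    have := hx (Finsupp.single i 1)
    rw [hc] at this
    exact isUnit_of_dvd_one this

/-- Alternants are divisible by the Vandermonde alternant `ε · x ^ δ`. -/
theorem alternant_zero_dvd (N : ℕ) (β : Fin N → ℕ) : alternant N 0 ∣ alternant N β := by
  classical
  rw [alternant_zero_eq, Finset.prod_sigma']
  have hne : ∀ a ∈ (Finset.univ : Finset (Fin N)).sigma fun i => Finset.Ioi i, a.1 ≠ a.2 := by
    intro a ha
    simp only [Finset.mem_sigma, Finset.mem_Ioi] at ha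
    exact ha.2.ne
  refine Finset.prod_dvd_of_isRelPrime ?_ ?_
  · intro a ha b hb hab
    have ha' := ha
    have hb' := hb
    simp only [Finset.coe_sigma, Set.mem_sigma_iff, Finset.mem_coe, Finset.mem_Ioi] at ha' hb'
    refine (irreducible_X_sub_X (hne a ha)).isRelPrime_iff_not_dvd.2 fun hdvd => hab ?_
    have h0 := map_dvd (MvPolynomial.aeval (R := ℂ) (fun k => if k = a.2 then
      (MvPolynomial.X a.1 : MvPolynomial (Fin N) ℂ) else MvPolynomial.X k)) hdvd
    simp only [map_sub, MvPolynomial.aeval_X, if_neg (hne a ha), if_true, sub_self,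
      zero_dvd_iff, sub_eq_zero] at h0
    obtain ⟨a1, a2⟩ := a
    obtain ⟨b1, b2⟩ := b
    have hI : Function.Injective (MvPolynomial.X : Fin N → MvPolynomial (Fin N) ℂ) :=
      MvPolynomial.X_injective
    have hlt1 : a1 < a2 := ha'.2
    have hlt2 : b1 < b2 := hb'.2
    simp only at h0
    split_ifs at h0 with h1 h2 h2
    · exact absurd (h1.trans h2.symm) hlt2.ne
    · have := hI h0
      subst this h1
      exact absurd hlt1 hlt2.asymm
    · have := hI h0
      subst this h2
      rfl
    · exact absurd (hI h0) hlt2.ne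
  · intro a ha
    refine X_sub_X_dvd ?_
    rw [alternant_eq_det, AlgHom.map_det]
    refine Matrix.det_zero_of_row_eq (hne a ha) ?_
    ext1 k
    simp [hne a ha]

/-- The Schur polynomial `s_λ(x₁, …, x_N) = (ε · x ^ (λ + δ)) / (ε · x ^ δ)` in `N` variables
(meaningful when `N` is at least the number of rows of `λ`). -/
def schurPoly (N : ℕ) (lam : YoungDiagram) : MvPolynomial (Fin N) ℂ :=
  Classical.choose (alternant_zero_dvd N fun i => lam.rowLen i)

theorem schurPoly_spec (N : ℕ) (lam : YoungDiagram) :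
    alternant N 0 * schurPoly N lam = alternant N fun i => lam.rowLen i :=
  (Classical.choose_spec (alternant_zero_dvd N fun i => lam.rowLen i)).symm

/-- The Schur function `s_λ = lim_{N → ∞} s_λ(x₁, …, x_N)`, a coefficientwise limit. -/
def schur (lam : YoungDiagram) : MvPowerSeries ℕ ℂ := fun m =>
  Filter.limUnder Filter.atTop fun N : ℕ =>
    MvPolynomial.coeff m (MvPolynomial.rename (fun i : Fin N => (i : ℕ)) (schurPoly N lam))

/-- Setting the last variable to zero. -/
def killLast (N : ℕ) : MvPolynomial (Fin (N + 1)) ℂ →ₐ[ℂ] MvPolynomial (Fin N) ℂ :=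
  MvPolynomial.aeval (Fin.lastCases 0 fun i => MvPolynomial.X i)

theorem killLast_alternant (N : ℕ) (β : Fin (N + 1) → ℕ) (h : β (Fin.last N) = 0) :
    killLast N (alternant (N + 1) β) =
      (∏ i : Fin N, MvPolynomial.X i) * alternant N fun i => β i.castSucc := by
  rw [alternant_eq_det, AlgHom.map_det, Matrix.det_succ_row _ (Fin.last N), alternant_eq_det,
    ← Matrix.det_mul_column, Finset.sum_eq_single (Fin.last N)]
  · simp only [Fin.val_last, AlgHom.mapMatrix_apply, Matrix.map_apply, Matrix.of_apply, map_pow]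
    rw [← two_mul, pow_mul]
    simp only [h, killLast]
    simp only [even_two, Even.neg_pow, one_pow, MvPolynomial.aeval_X, Fin.lastCases_last,
      add_tsub_cancel_right, tsub_self, add_zero, pow_zero, one_mul]
    congr 1
    ext1 i j
    simp only [Matrix.submatrix_apply, Matrix.map_apply, Matrix.of_apply, map_pow,
      MvPolynomial.aeval_X, Fin.succAbove_last, Fin.lastCases_castSucc, Fin.val_castSucc]
    rw [← pow_succ']
    congr 1
    omega
  · intro j _ hj
    have hj' : (j : ℕ) < N := Fin.val_lt_last hj
    have : killLast N (MvPolynomial.X (Fin.last N)) = 0 := by simp [killLast]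
    simp only [AlgHom.mapMatrix_apply, Matrix.map_apply, Matrix.of_apply, map_pow, this]
    rw [zero_pow (by omega)]
    simp
  · simp

theorem killLast_schurPoly (N : ℕ) (lam : YoungDiagram) (h : lam.colLen 0 ≤ N) :
    killLast N (schurPoly (N + 1) lam) = schurPoly N lam := by
  have h0 : lam.rowLen N = 0 := by
    by_contra hne
    have : (N, 0) ∈ lam := YoungDiagram.mem_iff_lt_rowLen.2 (Nat.pos_of_ne_zero hne)
    rw [YoungDiagram.mem_iff_lt_colLen] at this
    omega
  have e := congrArg (killLast N) (schurPoly_spec (N + 1) lam)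
  rw [map_mul, killLast_alternant _ _ rfl, killLast_alternant _ _ (by simpa using h0)] at e
  have e2 := schurPoly_spec N lam
  have hX : (∏ i : Fin N, (MvPolynomial.X i : MvPolynomial (Fin N) ℂ)) ≠ 0 :=
    Finset.prod_ne_zero_iff.2 fun i _ => MvPolynomial.X_ne_zero i
  have e3 : (∏ i : Fin N, (MvPolynomial.X i : MvPolynomial (Fin N) ℂ)) *
      (alternant N 0 * killLast N (schurPoly (N + 1) lam)) =
      (∏ i : Fin N, MvPolynomial.X i) * (alternant N 0 * schurPoly N lam) := by
    rw [e2, ← mul_assoc]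
    exact e
  exact mul_left_cancel₀ (alternant_zero_ne_zero N) (mul_left_cancel₀ hX e3)

theorem coeff_rename_killLast (N : ℕ) (p : MvPolynomial (Fin (N + 1)) ℂ) (m : ℕ →₀ ℕ)
    (hm : m N = 0) :
    MvPolynomial.coeff m (MvPolynomial.rename (fun i : Fin (N + 1) => (i : ℕ)) p) =
      MvPolynomial.coeff m (MvPolynomial.rename (fun i : Fin N => (i : ℕ)) (killLast N p)) := by
  have key : (MvPolynomial.X N : MvPolynomial ℕ ℂ) ∣
      MvPolynomial.rename (fun i : Fin (N + 1) => (i : ℕ)) p -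
        MvPolynomial.rename (fun i : Fin N => (i : ℕ)) (killLast N p) := by
    induction p using MvPolynomial.induction_on with
    | C a => simp [killLast]
    | add p q hp hq =>
      rw [map_add, map_add, map_add, add_sub_add_comm]
      exact dvd_add hp hq
    | mul_X p k hp =>
      rw [map_mul, map_mul, map_mul]
      refine Fin.lastCases ?_ (fun i => ?_) k
      · have : killLast N (MvPolynomial.X (Fin.last N)) = 0 := by simp [killLast]
        rw [this]
        simp
      · have : killLast N (MvPolynomial.X i.castSucc) = MvPolynomial.X i := by simp [killLast]
        rw [this, MvPolynomial.rename_X, MvPolynomial.rename_X, Fin.val_castSucc, ← sub_mul]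
        exact hp.mul_right _
  obtain ⟨q, hq⟩ := key
  rw [← sub_eq_zero, ← MvPolynomial.coeff_sub, hq, MvPolynomial.coeff_X_mul', if_neg]
  simpa using hm

/-- The limit that defines the Schur function exists: each coefficient is eventually constant. -/
theorem coeff_schur (lam : YoungDiagram) (m : ℕ →₀ ℕ) (N : ℕ) (hN : lam.colLen 0 ≤ N)
    (hm : ∀ i, N ≤ i → m i = 0) :
    MvPowerSeries.coeff m (schur lam) = MvPolynomial.coeff m
      (MvPolynomial.rename (fun i : Fin N => (i : ℕ)) (schurPoly N lam)) := by
  refine Filter.Tendsto.limUnder_eq (tendsto_const_nhds.congr' ?_)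
  filter_upwards [Filter.eventually_ge_atTop N] with M hM
  induction M, hM using Nat.le_induction with
  | base => rfl
  | succ M hM ih =>
    rw [ih, coeff_rename_killLast M _ m (hm M hM), killLast_schurPoly M lam (hN.trans hM)]

/-! ### Class functions, partial permutations and atomic symmetric functions -/

/-- The Reynolds operator, `(R f)(w) = (1 / n!) ∑ v, f (v⁻¹ w v)`. -/
def reynolds {n : ℕ} (f : Equiv.Perm (Fin n) → ℂ) : Equiv.Perm (Fin n) → ℂ := fun w =>
  (1 / (n ! : ℂ)) * ∑ v : Equiv.Perm (Fin n), f (v⁻¹ * w * v)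

/-- The Frobenius characteristic, `ch_n f = (1 / n!) ∑ w, f(w) p_{cyc(w)}`. Here
`Equiv.Perm.partition w` is the cycle type of `w`, fixed points included. -/
def frobeniusChar {n : ℕ} (f : Equiv.Perm (Fin n) → ℂ) : MvPowerSeries ℕ ℂ :=
  (1 / (n ! : ℂ)) • ∑ w : Equiv.Perm (Fin n), f w • powerSumPart w.partition

/-- A partial permutation `(I, J)` of an `n`-element set: two sequences of distinct elements, of
the same length. -/
structure PartialPerm (n : ℕ) where
  size : ℕ
  I : Fin size ↪ Fin n
  J : Fin size ↪ Fin n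

/-- The graph of `(I, J)`: the directed edges are `I t → J t`. -/
def PartialPerm.graph {n : ℕ} (P : PartialPerm n) : Digraph (Fin n) where
  Adj a b := ∃ t, P.I t = a ∧ P.J t = b

/-- The indicator statistic of the permutations `w` with `w(I) = J`. -/
def PartialPerm.indicator {n : ℕ} (P : PartialPerm n) (w : Equiv.Perm (Fin n)) : ℂ :=
  open Classical in if ∀ t, w (P.I t) = P.J t then 1 else 0

/-- The atomic symmetric function `A_{n,I,J} = n! · ch_n (R 1_{I,J})`. -/
def atomic {n : ℕ} (P : PartialPerm n) : MvPowerSeries ℕ ℂ :=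
  (n ! : ℂ) • frobeniusChar (reynolds P.indicator)

/-- `A_{n,I,J}` depends only on the isomorphism class of the graph of `(I, J)`. -/
theorem atomic_eq_of_graph_iso {n : ℕ} {P Q : PartialPerm n}
    (e : P.graph.Adj ≃r Q.graph.Adj) : atomic P = atomic Q := by
  have hind : ∀ w : Equiv.Perm (Fin n),
      Q.indicator w = P.indicator (e.toEquiv⁻¹ * w * e.toEquiv) := by
    intro w
    have hP : ∀ (R : PartialPerm n) (w : Equiv.Perm (Fin n)),
        (∀ t, w (R.I t) = R.J t) ↔ ∀ a b, R.graph.Adj a b → w a = b := by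
      intro R w
      constructor
      · rintro h a b ⟨t, rfl, rfl⟩
        exact h t
      · exact fun h t => h _ _ ⟨t, rfl, rfl⟩
    unfold PartialPerm.indicator
    refine if_congr ?_ rfl rfl
    rw [hP, hP]
    constructor
    · intro h a b hab
      have := h _ _ (e.map_rel_iff.2 hab)
      simp only [Equiv.Perm.mul_apply]
      rw [Equiv.Perm.inv_eq_iff_eq]
      exact this
    · intro h a b hab
      have := h (e.symm a) (e.symm b) (e.symm.map_rel_iff.2 hab)
      simp only [Equiv.Perm.mul_apply] at this
      rw [Equiv.Perm.inv_eq_iff_eq] at this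
      simpa using this
  have hR : reynolds Q.indicator = reynolds P.indicator := by
    funext w
    unfold reynolds
    congr 1
    refine Fintype.sum_equiv (Equiv.mulRight e.toEquiv) _ _ fun v => ?_
    rw [hind]
    congr 1
  unfold atomic
  rw [hR]

/-- The disjoint union `P_{α₁} ⊔ ⋯ ⊔ P_{α_k}` of directed paths with `α₁, …, α_k` vertices. -/
def pathUnion {n : ℕ} (α : Composition n) :
    Digraph (Σ i : Fin α.length, Fin (α.blocksFun i)) where
  Adj x y := x.1 = y.1 ∧ (x.2 : ℕ) + 1 = (y.2 : ℕ)

theorem exists_partialPerm {n : ℕ} (α : Composition n) :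
    ∃ P : PartialPerm n, Nonempty (P.graph.Adj ≃r (pathUnion α).Adj) := by
  classical
  let E := {x : Σ i : Fin α.length, Fin (α.blocksFun i) // (x.2 : ℕ) + 1 < α.blocksFun x.1}
  let e : Fin (Fintype.card E) ≃ E := (Fintype.equivFin E).symm
  let nxt : E → Σ i : Fin α.length, Fin (α.blocksFun i) := fun x =>
    ⟨x.1.1, ⟨(x.1.2 : ℕ) + 1, x.2⟩⟩
  have hnxt : Function.Injective nxt := by
    rintro ⟨⟨i, a⟩, ha⟩ ⟨⟨j, b⟩, hb⟩ h
    simp only [nxt, Sigma.mk.injEq] at h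
    obtain ⟨rfl, h⟩ := h
    simp only [heq_eq_eq, Fin.mk.injEq, add_left_inj] at h
    have : a = b := Fin.ext h
    subst this
    rfl
  refine ⟨⟨Fintype.card E, ⟨fun t => α.blocksFinEquiv (e t).1, ?_⟩,
    ⟨fun t => α.blocksFinEquiv (nxt (e t)), ?_⟩⟩, ⟨⟨α.blocksFinEquiv.symm, ?_⟩⟩⟩
  · exact α.blocksFinEquiv.injective.comp (Subtype.val_injective.comp e.injective)
  · exact α.blocksFinEquiv.injective.comp (hnxt.comp e.injective)
  · intro a b
    constructor
    · rintro ⟨h1, h2⟩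
      obtain ⟨⟨i, x⟩, rfl⟩ := α.blocksFinEquiv.surjective a
      obtain ⟨⟨j, y⟩, rfl⟩ := α.blocksFinEquiv.surjective b
      rw [Equiv.symm_apply_apply, Equiv.symm_apply_apply] at h1
      have h2 : (x : ℕ) + 1 = y := by
        have e1 := α.blocksFinEquiv.symm_apply_apply ⟨i, x⟩
        have e2 := α.blocksFinEquiv.symm_apply_apply ⟨j, y⟩
        rw [e1, e2] at h2
        exact h2
      simp only at h1
      subst h1
      refine ⟨e.symm ⟨⟨i, x⟩, ?_⟩, ?_, ?_⟩
      · show (x : ℕ) + 1 < α.blocksFun i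
        rw [h2]
        exact y.2
      · simp
      · have hn : ∀ h, nxt ⟨⟨i, x⟩, h⟩ = ⟨i, y⟩ := fun h => by
          simp only [nxt]
          congr 1
          exact Fin.ext h2
        simp [hn]
    · rintro ⟨t, rfl, rfl⟩
      simp only [Function.Embedding.coeFn_mk, Equiv.symm_apply_apply, pathUnion, nxt, and_self]

/-- The path power sum of a composition `α`: the atomic symmetric function of any partial
permutation whose graph is, up to labels, the disjoint union of the paths `P_{αᵢ}`
(see `atomic_eq_of_graph_iso` for the independence of the choice). -/
def pathPowerSum {n : ℕ} (α : Composition n) : MvPowerSeries ℕ ℂ :=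
  atomic (Classical.choose (exists_partialPerm α))

/-- A partition as a composition: its parts in weakly decreasing order. -/
def sortedParts {n : ℕ} (μ : n.Partition) : Composition n where
  blocks := μ.parts.sort (· ≥ ·)
  blocks_pos := fun h => μ.parts_pos (by simpa using h)
  blocks_sum := by
    rw [← Multiset.sum_coe, Multiset.sort_eq, μ.parts_sum]

/-- `m(μ)! = ∏_{i ≥ 1} m_i(μ)!`, where `m_i(μ)` is the multiplicity of `i` as a part of `μ`. -/
def multFactorial {n : ℕ} (μ : n.Partition) : ℕ :=
  ∏ i ∈ μ.parts.toFinset, (μ.parts.count i)!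

/-! ### Ribbons and monotonic ribbon tilings

The cell `(i, j)` lies in row `i` and column `j` (counted from `0`), rows being numbered from
north to south and columns from west to east. -/

/-- Two cells share an edge. -/
def CellAdj (a b : ℕ × ℕ) : Prop :=
  (a.1 = b.1 ∧ (a.2 + 1 = b.2 ∨ b.2 + 1 = a.2)) ∨
    (a.2 = b.2 ∧ (a.1 + 1 = b.1 ∨ b.1 + 1 = a.1))

/-- A ribbon: a nonempty edgewise connected skew shape without `2 × 2` squares. -/
structure IsRibbon (ξ : Finset (ℕ × ℕ)) : Prop where
  skew : ∃ ρ ν : YoungDiagram, ρ ≤ ν ∧ ξ = ν.cells \ ρ.cells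
  nonempty : ξ.Nonempty
  connected : ∀ a ∈ ξ, ∀ b ∈ ξ,
    Relation.ReflTransGen (fun x y => x ∈ ξ ∧ y ∈ ξ ∧ CellAdj x y) a b
  no_square : ∀ i j, ¬((i, j) ∈ ξ ∧ (i + 1, j) ∈ ξ ∧ (i, j + 1) ∈ ξ ∧ (i + 1, j + 1) ∈ ξ)

/-- The height: the number of rows occupied, less one. -/
def height (ξ : Finset (ℕ × ℕ)) : ℕ := (ξ.image Prod.fst).card - 1

/-- The sign `(-1) ^ ht(ξ)`. -/
def ribbonSign (ξ : Finset (ℕ × ℕ)) : ℤ := (-1) ^ height ξ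

/-- The tail: the southwesternmost cell, i.e. the westernmost cell of the southernmost row. -/
def tail (ξ : Finset (ℕ × ℕ)) : ℕ × ℕ :=
  (ξ.sup Prod.fst, sInf {j | (ξ.sup Prod.fst, j) ∈ ξ})

/-- A monotonic ribbon tiling: a decomposition of the Young diagram `shape` into disjoint ribbons
whose tails lie in distinct columns and such that, when the ribbons are listed by increasing
columns of their tails, each initial union of ribbons is a Young diagram. -/
@[ext]
structure MonotonicTiling where
  shape : YoungDiagram
  ribbons : List (Finset (ℕ × ℕ))
  isRibbon : ∀ ξ ∈ ribbons, IsRibbon ξ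
  disjoint : ribbons.Pairwise Disjoint
  cover : ∀ c, c ∈ shape ↔ ∃ ξ ∈ ribbons, c ∈ ξ
  tails : ribbons.Pairwise fun ξ η => (tail ξ).2 < (tail η).2
  initial : ∀ i ≤ ribbons.length, ∃ ν : YoungDiagram, ∀ c, c ∈ ν ↔ ∃ ξ ∈ ribbons.take i, c ∈ ξ

/-- The sign of a tiling: the product of the signs of its ribbons. -/
def MonotonicTiling.sign (T : MonotonicTiling) : ℤ := (T.ribbons.map ribbonSign).prod

/-- The type of a tiling: the sizes of its ribbons, read from left to right. -/
def MonotonicTiling.type (T : MonotonicTiling) : List ℕ := T.ribbons.map Finset.card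

/-- The monotonic ribbon tilings `T` such that sorting `type(T)` gives `μ`, i.e. such that the
multiset of ribbon sizes is the multiset of parts of `μ`. -/
def TilingsOfType {n : ℕ} (μ : n.Partition) : Type :=
  {T : MonotonicTiling // (T.type : Multiset ℕ) = μ.parts}

theorem lt_card_of_mem (lam : YoungDiagram) (c : ℕ × ℕ) (hc : c ∈ lam) :
    c.1 < lam.card ∧ c.2 < lam.card := by
  obtain ⟨i, j⟩ := c
  constructor
  · refine (YoungDiagram.mem_iff_lt_colLen.1 hc).trans_le ?_
    rw [YoungDiagram.colLen_eq_card]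
    exact Finset.card_le_card (Finset.filter_subset _ _)
  · refine (YoungDiagram.mem_iff_lt_rowLen.1 hc).trans_le ?_
    rw [YoungDiagram.rowLen_eq_card]
    exact Finset.card_le_card (Finset.filter_subset _ _)

theorem MonotonicTiling.ext_ribbons {T T' : MonotonicTiling} (h : T.ribbons = T'.ribbons) :
    T = T' := by
  refine MonotonicTiling.ext ?_ h
  refine SetLike.ext fun c => ?_
  rw [T.cover, T'.cover, h]

theorem MonotonicTiling.card_shape_le (T : MonotonicTiling) : T.shape.card ≤ T.type.sum := by
  classical
  have hgen : ∀ l : List (Finset (ℕ × ℕ)),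
      (l.foldr (· ∪ ·) ∅).card ≤ (l.map Finset.card).sum := by
    intro l
    induction l with
    | nil => simp
    | cons a l ih =>
      simp only [List.foldr_cons, List.map_cons, List.sum_cons]
      exact (Finset.card_union_le _ _).trans (by omega)
  have hmem : ∀ (l : List (Finset (ℕ × ℕ))) (c : ℕ × ℕ),
      c ∈ l.foldr (· ∪ ·) ∅ ↔ ∃ ξ ∈ l, c ∈ ξ := by
    intro l c
    induction l with
    | nil => simp
    | cons a l ih => simp [ih]
  refine (Finset.card_le_card fun c hc => ?_).trans (hgen T.ribbons)
  rw [hmem]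
  exact (T.cover c).1 hc

instance {n : ℕ} (μ : n.Partition) : Finite (TilingsOfType μ) := by
  classical
  let B : Finset (ℕ × ℕ) := Finset.range n ×ˢ Finset.range n
  have hfin : {l : List {ξ : Finset (ℕ × ℕ) // ξ ∈ B.powerset} |
      l.length ≤ μ.parts.card}.Finite := List.finite_length_le _ _
  have hinj : Function.Injective fun T : TilingsOfType μ => T.1.ribbons := fun T T' hTT =>
    Subtype.ext (MonotonicTiling.ext_ribbons hTT)
  refine (Set.finite_range_iff hinj).1 ((hfin.image (List.map Subtype.val)).subset ?_)
  rintro _ ⟨⟨T, hT⟩, rfl⟩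
  have hsum : T.type.sum = n := by
    rw [← Multiset.sum_coe, hT, μ.parts_sum]
  have hlen : T.ribbons.length = μ.parts.card := by
    rw [← hT, Multiset.coe_card, MonotonicTiling.type, List.length_map]
  have hsub : ∀ ξ ∈ T.ribbons, ξ ∈ B.powerset := by
    intro ξ hξ
    rw [Finset.mem_powerset]
    intro c hc
    have h := lt_card_of_mem T.shape c ((T.cover c).2 ⟨ξ, hξ, hc⟩)
    have hle := T.card_shape_le
    simp only [B, Finset.mem_product, Finset.mem_range]
    omega
  refine ⟨T.ribbons.attachWith (· ∈ B.powerset) hsub, ?_, ?_⟩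
  · simp [hlen]
  · simp

instance {n : ℕ} (μ : n.Partition) : Fintype (TilingsOfType μ) := Fintype.ofFinite _

end

end PathMN

/-! A permutation extending a disjoint union of `r` paths joins the end of each path to the start of
some path, so these extensions are indexed by `σ ∈ 𝔖_r`. In `N` variables the power sum of a cycle
type enumerates the colourings constant on cycles, hence here the colourings `f` of the paths with
`f ∘ σ = f`. Summing over `σ` first gives `∑_f ∏_i |f⁻¹(i)|! · ∏_s x_{f(s)}^{b_s}`, where `b_s` is
the size of path `s`. Multiplication by `ε · x^δ` turns this into a sum of terms `ε · x^(δ + load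
f)`, with the factorials counting the orders in which the labels on each variable can be placed
(`fillingSum`).

The labels are now placed one at a time, from the last variable to the first and in the chosen order
on each variable. Each placement on variable `k` adds `b_s` to one entry of an exponent vector `λ +
δ`, that is, moves one bead. What remains to be summed runs over all fillings of the variables up to
`k`, so it alternates in the exponents at those positions (`fillingSum_comp_perm`). It vanishes if
the moved bead collides with another one; otherwise a cycle sorts the exponents, and the effect is
to add to `λ` a ribbon of size `b_s` with its tail in row `k`, with the sign of the ribbon
(`exists_ribbonRows_of_ne`, `RibbonRows.beads_comp_cycleIcc`).

The tails thus occur in weakly decreasing rows, which for successively added ribbons amounts to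
strictly increasing columns: the ribbons form a monotonic tiling. The induction over the variables
is `contributionSum_succ`. It yields alternants indexed by tilings with labelled ribbons; each
unlabelled tiling has `m(μ)!` labellings (`sum_labelledTiling`), and cancelling `ε · x^δ` leaves
Schur polynomials. -/

namespace PathMN

noncomputable section

/-! ### Fillings of the variables by labelled parts -/

/-- The antisymmetrization `ε · x ^ γ`. -/
def antisymmetrize {N : ℕ} (γ : Fin N → ℕ) : MvPolynomial (Fin N) ℂ :=
  ∑ w : Equiv.Perm (Fin N), (Equiv.Perm.sign w : ℤ) •
    MvPolynomial.rename w (∏ i : Fin N, MvPolynomial.X i ^ γ i)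

theorem antisymmetrize_comp_perm {N : ℕ} (γ : Fin N → ℕ) (π : Equiv.Perm (Fin N)) :
    antisymmetrize (γ ∘ π) = (Equiv.Perm.sign π : ℤ) • antisymmetrize γ := by
  unfold antisymmetrize
  rw [Finset.smul_sum]
  refine Fintype.sum_equiv (Equiv.mulRight π⁻¹) _ _ fun w => ?_
  have h1 : (∏ i : Fin N, (MvPolynomial.X i : MvPolynomial (Fin N) ℂ) ^ (γ ∘ π) i) =
      MvPolynomial.rename (π⁻¹ : Equiv.Perm (Fin N)) (∏ i : Fin N, MvPolynomial.X i ^ γ i) := by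
    rw [map_prod, ← Equiv.prod_comp π
      (fun i => MvPolynomial.rename (π⁻¹ : Equiv.Perm (Fin N)) (MvPolynomial.X i ^ γ i))]
    simp
  rw [h1, MvPolynomial.rename_rename, smul_smul]
  have h2 : ((Equiv.Perm.sign π : ℤ) * (Equiv.Perm.sign (Equiv.mulRight π⁻¹ w) : ℤ)) =
      (Equiv.Perm.sign w : ℤ) := by
    rw [Equiv.coe_mulRight, Equiv.Perm.sign_mul, Equiv.Perm.sign_inv, ← Units.val_mul,
      mul_comm, mul_assoc, Int.units_mul_self, mul_one]
  rw [h2]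
  rfl

theorem alternant_eq_antisymmetrize {N : ℕ} (β : Fin N → ℕ) :
    alternant N β = antisymmetrize fun i => β i + (N - 1 - (i : ℕ)) := rfl

section Fillings

variable {ι : Type*} [Fintype ι] [DecidableEq ι] {N : ℕ}

/-- Functions that put the labels in `S` on variables of index less than `k` and leave out the
other labels. -/
def fillings (N k : ℕ) (S : Finset ι) : Finset (ι → Option (Fin N)) :=
  open Classical in
  Finset.univ.filter fun f => ∀ s, (s ∉ S → f s = none) ∧
    (s ∈ S → ∃ i : Fin N, (i : ℕ) < k ∧ f s = some i)

theorem mem_fillings {k : ℕ} {S : Finset ι} {f : ι → Option (Fin N)} :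
    f ∈ fillings N k S ↔ ∀ s, (s ∉ S → f s = none) ∧
      (s ∈ S → ∃ i : Fin N, (i : ℕ) < k ∧ f s = some i) := by
  simp [fillings]

/-- The number of ways to order the labels put on each variable. -/
def orderings (f : ι → Option (Fin N)) : ℕ :=
  ∏ i : Fin N, (Finset.univ.filter fun s => f s = some i).card !

/-- The total size of the labels put on a variable. -/
def load (b : ι → ℕ) (f : ι → Option (Fin N)) (i : Fin N) : ℕ :=
  ∑ s with f s = some i, b s

/-- The sum of `ε · x ^ (γ + load f)` over the fillings `f` of the first `k` variables by the
labels in `S`, weighted by numbers of orderings. -/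
def fillingSum (b : ι → ℕ) (k : ℕ) (γ : Fin N → ℕ) (S : Finset ι) : MvPolynomial (Fin N) ℂ :=
  ∑ f ∈ fillings N k S, orderings f • antisymmetrize (γ + load b f)

/-- Relabelling variables by `π` permutes the fillings of the first `k` variables and preserves the
weights. Hence the alternation of the single terms passes to the sum: exponents may be sorted before
the remaining labels are placed. -/
theorem fillingSum_comp_perm (b : ι → ℕ) (k : ℕ) (γ : Fin N → ℕ) (S : Finset ι)
    (π : Equiv.Perm (Fin N)) (hπ : ∀ i : Fin N, k ≤ (i : ℕ) → π i = i) :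
    fillingSum b k (γ ∘ π) S = (Equiv.Perm.sign π : ℤ) • fillingSum b k γ S := by
  have hinv : ∀ i : Fin N, k ≤ (i : ℕ) → π⁻¹ i = i := fun i hi => by
    rw [Equiv.Perm.inv_eq_iff_eq, hπ i hi]
  have hlt : ∀ σ : Equiv.Perm (Fin N), (∀ i : Fin N, k ≤ (i : ℕ) → σ⁻¹ i = i) →
      ∀ i : Fin N, (i : ℕ) < k → ((σ i : Fin N) : ℕ) < k := by
    intro σ hσ i hi
    by_contra! hk
    have := hσ _ hk
    rw [Equiv.Perm.inv_eq_iff_eq] at this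
    rw [← σ.injective this] at hk
    omega
  have hmem : ∀ σ : Equiv.Perm (Fin N), (∀ i : Fin N, k ≤ (i : ℕ) → σ⁻¹ i = i) →
      ∀ f ∈ fillings N k S, (fun s => (f s).map σ) ∈ fillings N k S := by
    intro σ hσ f hf
    rw [mem_fillings] at hf ⊢
    intro s
    refine ⟨fun hs => by simp [(hf s).1 hs], fun hs => ?_⟩
    obtain ⟨i, hi, hfi⟩ := (hf s).2 hs
    exact ⟨σ i, hlt σ hσ i hi, by simp [hfi]⟩
  have hiff : ∀ (f : ι → Option (Fin N)) (s : ι) (i : Fin N),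
      (f s).map π = some (π i) ↔ f s = some i := by
    intro f s i
    cases h : f s <;> simp
  unfold fillingSum
  rw [Finset.smul_sum]
  refine Finset.sum_nbij' (fun f s => (f s).map π) (fun f s => (f s).map (π⁻¹ : Equiv.Perm (Fin N)))
    (hmem π hinv) (hmem π⁻¹ (by simpa using hπ)) ?_ ?_ ?_
  · intro f _
    funext s
    cases h : f s <;> simp [h]
  · intro f _
    funext s
    cases h : f s <;> simp [h]
  · intro f _
    have h1 : orderings (fun s => (f s).map π) = orderings f := by
      unfold orderings
      rw [← Equiv.prod_comp π]
      simp only [hiff]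
    have h2 : γ ∘ π + load b f = (γ + load b fun s => (f s).map π) ∘ π := by
      funext i
      simp only [Pi.add_apply, Function.comp_apply, load, hiff]
    rw [h1, h2, antisymmetrize_comp_perm, smul_comm]

/-- The transposition of `i` and `j` fixes `γ` but changes the sign of the sum. This disposes of
colliding beads. -/
theorem fillingSum_eq_zero (b : ι → ℕ) (k : ℕ) (γ : Fin N → ℕ) (S : Finset ι) {i j : Fin N}
    (hij : i ≠ j) (hi : (i : ℕ) < k) (hj : (j : ℕ) < k) (h : γ i = γ j) :
    fillingSum b k γ S = 0 := by
  have h1 := fillingSum_comp_perm b k γ S (Equiv.swap i j) fun l hl =>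
    Equiv.swap_apply_of_ne_of_ne (by rintro rfl; omega) (by rintro rfl; omega)
  have h2 : γ ∘ Equiv.swap i j = γ := by
    funext l
    rcases eq_or_ne l i with rfl | hli
    · simp [h]
    rcases eq_or_ne l j with rfl | hlj
    · simp [h]
    simp [Equiv.swap_apply_of_ne_of_ne hli hlj]
  rw [h2, Equiv.Perm.sign_swap hij] at h1
  simp only [Units.val_neg, Units.val_one, neg_smul, one_smul] at h1
  exact self_eq_neg.1 h1

/-- An ordering of the labels on variable `k` is a first label followed by an ordering of the
others. The factor `m!` becomes `m` equal terms with factor `(m - 1)!`. -/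
theorem orderings_smul_eq_sum {M : Type*} [AddCommMonoid M] (f : ι → Option (Fin N)) (k : Fin N)
    (hk : ∃ s, f s = some k) (x : M) :
    orderings f • x = ∑ s with f s = some k, orderings (Function.update f s none) • x := by
  have key : ∀ s, f s = some k → orderings f =
      (Finset.univ.filter fun s => f s = some k).card * orderings (Function.update f s none) := by
    intro s hs
    have hf : ∀ i, (Finset.univ.filter fun t => Function.update f s none t = some i) =
        (Finset.univ.filter fun t => f t = some i).erase s := by
      intro i
      ext t
      rcases eq_or_ne t s with rfl | hts <;> simp [*]
    unfold orderings
    rw [← Finset.mul_prod_erase _ _ (Finset.mem_univ k),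
      ← Finset.mul_prod_erase _ _ (Finset.mem_univ k), ← mul_assoc]
    have hs' : s ∈ Finset.univ.filter fun t => f t = some k := by simpa using hs
    congr 1
    · rw [hf, Finset.card_erase_of_mem hs', Nat.mul_factorial_pred]
      exact (Finset.card_pos.2 ⟨s, hs'⟩).ne'
    · refine Finset.prod_congr rfl fun i hi => ?_
      rw [hf, Finset.erase_eq_of_notMem]
      simpa [hs] using (Finset.ne_of_mem_erase hi).symm
  obtain ⟨s₀, hs₀⟩ := hk
  have hconst : ∀ s ∈ Finset.univ.filter fun s => f s = some k,
      orderings (Function.update f s none) • x = orderings (Function.update f s₀ none) • x := by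
    intro s hs
    rw [Finset.mem_filter] at hs
    congr 1
    have h1 := (key s hs.2).symm.trans (key s₀ hs₀)
    exact Nat.eq_of_mul_eq_mul_left (Finset.card_pos.2 ⟨s₀, by simpa using hs₀⟩) h1
  rw [Finset.sum_congr rfl hconst, Finset.sum_const, key s₀ hs₀, mul_smul]

theorem load_update_none (b : ι → ℕ) (f : ι → Option (Fin N)) (k : Fin N) (s : ι)
    (hs : f s = some k) :
    load b f = Pi.single k (b s) + load b (Function.update f s none) := by
  have hf : ∀ i, (Finset.univ.filter fun t => Function.update f s none t = some i) =
      (Finset.univ.filter fun t => f t = some i).erase s := by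
    intro i
    ext t
    rcases eq_or_ne t s with rfl | hts <;> simp [*]
  funext i
  simp only [Pi.add_apply, load, hf]
  rcases eq_or_ne i k with rfl | hik
  · rw [Pi.single_eq_same, Finset.add_sum_erase]
    simpa using hs
  · rw [Pi.single_eq_of_ne hik, zero_add, Finset.erase_eq_of_notMem]
    simpa [hs] using hik.symm

/-- Splitting off the first label put on the variable of index `k`. -/
theorem fillingSum_succ (b : ι → ℕ) (k : Fin N) (γ : Fin N → ℕ) (S : Finset ι) :
    fillingSum b (k + 1) γ S = fillingSum b k γ S +
      ∑ s ∈ S, fillingSum b (k + 1) (γ + Pi.single k (b s)) (S.erase s) := by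
  classical
  unfold fillingSum
  -- Fillings that avoid variable `k` are fillings of the first `k` variables. In the others, a
  -- first label on `k` is split off and its size is moved into the exponent.
  rw [← Finset.sum_filter_not_add_sum_filter (fillings N (k + 1) S) (fun f => ∃ s, f s = some k)]
  congr 1
  · refine Finset.sum_congr ?_ fun _ _ => rfl
    ext f
    rw [Finset.mem_filter, mem_fillings, mem_fillings]
    constructor
    · rintro ⟨hf, hk⟩ s
      refine ⟨(hf s).1, fun hs => ?_⟩
      obtain ⟨i, hi, hfi⟩ := (hf s).2 hs
      refine ⟨i, lt_of_le_of_ne (Nat.lt_succ_iff.1 hi) fun h => hk ⟨s, ?_⟩, hfi⟩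
      rw [hfi, Fin.ext h]
    · intro hf
      refine ⟨fun s => ⟨(hf s).1, fun hs => ?_⟩, ?_⟩
      · obtain ⟨i, hi, hfi⟩ := (hf s).2 hs
        exact ⟨i, by omega, hfi⟩
      · rintro ⟨s, hs⟩
        by_cases hS : s ∈ S
        · obtain ⟨i, hi, hfi⟩ := (hf s).2 hS
          rw [hs] at hfi
          cases hfi
          omega
        · simp [(hf s).1 hS] at hs
  · calc
      _ = ∑ f ∈ (fillings N (k + 1) S).filter (fun f => ∃ s, f s = some k),
            ∑ s with f s = some k, orderings (Function.update f s none) •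
              antisymmetrize (γ + load b f) :=
          Finset.sum_congr rfl fun f hf =>
            orderings_smul_eq_sum f k (Finset.mem_filter.1 hf).2 _
      _ = ∑ s ∈ S, ∑ f ∈ (fillings N (k + 1) S).filter (fun f => f s = some k),
            orderings (Function.update f s none) • antisymmetrize (γ + load b f) := by
          refine Finset.sum_comm' fun f s => ?_
          simp only [Finset.mem_filter, Finset.mem_univ, true_and]
          constructor
          · rintro ⟨⟨hf, _⟩, hs⟩
            refine ⟨⟨hf, hs⟩, ?_⟩
            by_contra hS
            simp [(mem_fillings.1 hf s).1 hS] at hs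
          · rintro ⟨⟨hf, hs⟩, _⟩
            exact ⟨⟨hf, s, hs⟩, hs⟩
      _ = _ := by
          refine Finset.sum_congr rfl fun s hs => ?_
          refine Finset.sum_nbij' (fun f => Function.update f s none)
            (fun f => Function.update f s (some k)) ?_ ?_ ?_ ?_ ?_
          · intro f hf
            rw [Finset.mem_filter, mem_fillings] at hf
            rw [mem_fillings]
            intro t
            rcases eq_or_ne t s with rfl | hts
            · simp
            · simpa [hts] using hf.1 t
          · intro f hf
            rw [mem_fillings] at hf
            rw [Finset.mem_filter, mem_fillings]
            refine ⟨fun t => ?_, by simp⟩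
            rcases eq_or_ne t s with rfl | hts
            · simp [hs]
            · simpa [hts] using hf t
          · intro f hf
            rw [Finset.mem_filter] at hf
            rw [Function.update_idem, ← hf.2, Function.update_eq_self]
          · intro f hf
            have : f s = none := (mem_fillings.1 hf s).1 (by simp)
            rw [Function.update_idem, ← this, Function.update_eq_self]
          · intro f hf
            rw [Finset.mem_filter] at hf
            rw [load_update_none b f k s hf.2, add_assoc]

theorem fillingSum_zero (b : ι → ℕ) (γ : Fin N → ℕ) (S : Finset ι) :
    fillingSum b 0 γ S = if S = ∅ then antisymmetrize γ else 0 := by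
  classical
  unfold fillingSum
  split_ifs with hS
  · have : fillings N 0 S = {fun _ => none} := by
      ext f
      rw [mem_fillings, Finset.mem_singleton, funext_iff]
      simp [hS]
    rw [this, Finset.sum_singleton]
    have h0 : γ + load b (fun _ : ι => none) = γ := by
      funext i
      simp [load]
    rw [h0]
    simp [orderings]
  · have : fillings N 0 S = ∅ := by
      obtain ⟨s, hs⟩ := Finset.nonempty_iff_ne_empty.2 hS
      refine Finset.eq_empty_of_forall_notMem fun f hf => ?_
      obtain ⟨i, hi, _⟩ := (mem_fillings.1 hf s).2 hs
      omega
    rw [this, Finset.sum_empty]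

end Fillings

/-! ### Row lengths of ribbons -/

theorem mem_sdiff_iff {lam nu : YoungDiagram} {i j : ℕ} :
    (i, j) ∈ nu.cells \ lam.cells ↔ lam.rowLen i ≤ j ∧ j < nu.rowLen i := by
  rw [Finset.mem_sdiff, YoungDiagram.mem_cells, YoungDiagram.mem_cells,
    YoungDiagram.mem_iff_lt_rowLen, YoungDiagram.mem_iff_lt_rowLen, not_lt, and_comm]

theorem eq_of_rowLen_eq {lam nu : YoungDiagram} (h : ∀ i, lam.rowLen i = nu.rowLen i) :
    lam = nu := by
  refine SetLike.ext ?_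
  rintro ⟨i, j⟩
  rw [YoungDiagram.mem_iff_lt_rowLen, YoungDiagram.mem_iff_lt_rowLen, h]

theorem le_of_rowLen_le {lam nu : YoungDiagram} (h : ∀ i, lam.rowLen i ≤ nu.rowLen i) :
    lam ≤ nu := by
  rintro ⟨i, j⟩ hc
  rw [YoungDiagram.mem_iff_lt_rowLen] at hc ⊢
  exact hc.trans_le (h i)

theorem rowLen_mono {lam nu : YoungDiagram} (h : lam ≤ nu) (i : ℕ) :
    lam.rowLen i ≤ nu.rowLen i := by
  by_contra! hlt
  have h1 := h (YoungDiagram.mem_iff_lt_rowLen.2 hlt)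
  rw [YoungDiagram.mem_iff_lt_rowLen] at h1
  exact lt_irrefl _ h1

theorem exists_rowLen_eq (r : ℕ → ℕ) (hr : Antitone r) (M : ℕ) (hM : ∀ i, M ≤ i → r i = 0) :
    ∃ nu : YoungDiagram, ∀ i, nu.rowLen i = r i := by
  have hmem : ∀ i j, (i, j) ∈ (Finset.range M ×ˢ Finset.range (r 0)).filter
      (fun c => c.2 < r c.1) ↔ j < r i := by
    intro i j
    simp only [Finset.mem_filter, Finset.mem_product, Finset.mem_range]
    refine ⟨fun h => h.2, fun h => ⟨⟨?_, h.trans_le (hr (Nat.zero_le _))⟩, h⟩⟩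
    by_contra! hi
    rw [hM i hi] at h
    omega
  refine ⟨⟨(Finset.range M ×ˢ Finset.range (r 0)).filter (fun c => c.2 < r c.1), ?_⟩, fun i => ?_⟩
  · rintro ⟨i, j⟩ ⟨i', j'⟩ ⟨hi, hj⟩ h
    rw [Finset.mem_coe, hmem] at h ⊢
    have := hr hi
    simp only at hi hj this
    omega
  · refine eq_of_forall_lt_iff fun j => ?_
    rw [← YoungDiagram.mem_iff_lt_rowLen, ← YoungDiagram.mem_cells]
    exact hmem i j

/-- The row lengths of `nu` arise from those of `lam` by adding a ribbon in rows `t, …, k`. -/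
structure RibbonRows (lam nu : YoungDiagram) (t k : ℕ) : Prop where
  le : t ≤ k
  off : ∀ i, i < t ∨ k < i → nu.rowLen i = lam.rowLen i
  succ : ∀ i, t ≤ i → i < k → nu.rowLen (i + 1) = lam.rowLen i + 1
  top : lam.rowLen t < nu.rowLen t

namespace RibbonRows

variable {lam nu : YoungDiagram} {t k : ℕ}

theorem rowLen_lt (h : RibbonRows lam nu t k) {i : ℕ} (hti : t ≤ i) (hik : i ≤ k) :
    lam.rowLen i < nu.rowLen i := by
  rcases hti.eq_or_lt with rfl | hlt
  · exact h.top
  · obtain ⟨i, rfl⟩ := Nat.exists_eq_add_one_of_ne_zero (by omega : i ≠ 0)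
    rw [h.succ i (by omega) (by omega)]
    exact Nat.lt_succ_of_le (lam.rowLen_anti _ _ (Nat.le_succ i))

theorem lam_le (h : RibbonRows lam nu t k) : lam ≤ nu := by
  refine le_of_rowLen_le fun i => ?_
  by_cases hi : i < t ∨ k < i
  · rw [h.off i hi]
  · exact (h.rowLen_lt (by omega) (by omega)).le

theorem mem_rows (h : RibbonRows lam nu t k) {i j : ℕ} (hij : (i, j) ∈ nu.cells \ lam.cells) :
    t ≤ i ∧ i ≤ k := by
  rw [mem_sdiff_iff] at hij
  by_contra hi
  have := h.off i (by omega)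
  omega

theorem left_mem (h : RibbonRows lam nu t k) {i : ℕ} (hti : t ≤ i) (hik : i ≤ k) :
    (i, lam.rowLen i) ∈ nu.cells \ lam.cells :=
  mem_sdiff_iff.2 ⟨le_rfl, h.rowLen_lt hti hik⟩

theorem tail_eq (h : RibbonRows lam nu t k) :
    tail (nu.cells \ lam.cells) = (k, lam.rowLen k) := by
  have hsup : (nu.cells \ lam.cells).sup Prod.fst = k := by
    refine le_antisymm (Finset.sup_le ?_) ?_
    · rintro ⟨i, j⟩ hij
      exact (h.mem_rows hij).2
    · exact Finset.le_sup (f := Prod.fst) (h.left_mem h.le le_rfl)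
  unfold tail
  rw [hsup]
  congr 1
  refine IsLeast.csInf_eq ⟨h.left_mem h.le le_rfl, ?_⟩
  intro j hj
  exact (mem_sdiff_iff.1 hj).1

theorem height_eq (h : RibbonRows lam nu t k) : height (nu.cells \ lam.cells) = k - t := by
  have himg : (nu.cells \ lam.cells).image Prod.fst = Finset.Icc t k := by
    ext i
    rw [Finset.mem_image, Finset.mem_Icc]
    constructor
    · rintro ⟨⟨i', j⟩, hij, rfl⟩
      exact h.mem_rows hij
    · rintro ⟨h1, h2⟩
      exact ⟨_, h.left_mem h1 h2, rfl⟩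
  unfold height
  rw [himg, Nat.card_Icc]
  have := h.le
  omega

/-- The row lengths of the ribbon telescope along `succ`. In terms of beads, the bead of row `k`
moves by the size of the ribbon and becomes the bead of row `t`. -/
theorem card_add (h : RibbonRows lam nu t k) :
    (nu.cells \ lam.cells).card + lam.rowLen k = nu.rowLen t + (k - t) := by
  have h1 : (nu.cells \ lam.cells).card =
      ∑ i ∈ Finset.range (k + 1), (nu.rowLen i - lam.rowLen i) := by
    rw [Finset.card_eq_sum_card_fiberwise (f := Prod.fst) (t := Finset.range (k + 1))]
    · refine Finset.sum_congr rfl fun i _ => ?_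
      have : (nu.cells \ lam.cells).filter (fun c => c.1 = i) =
          {i} ×ˢ Finset.Ico (lam.rowLen i) (nu.rowLen i) := by
        ext ⟨a, b⟩
        rw [Finset.mem_filter, mem_sdiff_iff, Finset.mem_product, Finset.mem_singleton,
          Finset.mem_Ico]
        constructor
        · rintro ⟨h, rfl⟩
          exact ⟨rfl, h⟩
        · rintro ⟨rfl, h⟩
          exact ⟨h, rfl⟩
      rw [this, Finset.card_product, Finset.card_singleton, one_mul, Nat.card_Ico]
    · rintro ⟨i, j⟩ hij
      have := (h.mem_rows (Finset.mem_coe.1 hij)).2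
      simp only [Finset.coe_range, Set.mem_Iio]
      omega
  have h2 : ∀ m, t ≤ m → m ≤ k →
      ∑ i ∈ Finset.range (m + 1), (nu.rowLen i - lam.rowLen i) + lam.rowLen m =
        nu.rowLen t + (m - t) := by
    intro m htm
    induction m, htm using Nat.le_induction with
    | base =>
      intro _
      rw [Finset.sum_range_succ, Finset.sum_eq_zero]
      · have := h.top
        omega
      · intro i hi
        rw [h.off i (Or.inl (Finset.mem_range.1 hi)), Nat.sub_self]
    | succ m hm ih =>
      intro hk
      rw [Finset.sum_range_succ]
      have := ih (by omega)
      have := h.succ m hm (by omega)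
      have := h.rowLen_lt (i := m + 1) (by omega) hk
      omega
  rw [h1]
  exact h2 k h.le le_rfl

theorem isRibbon (h : RibbonRows lam nu t k) : IsRibbon (nu.cells \ lam.cells) where
  skew := ⟨lam, nu, h.lam_le, rfl⟩
  nonempty := ⟨_, h.left_mem h.le le_rfl⟩
  connected := by
    set R : ℕ × ℕ → ℕ × ℕ → Prop := fun x y =>
      x ∈ nu.cells \ lam.cells ∧ y ∈ nu.cells \ lam.cells ∧ CellAdj x y with hR
    have hsymm : ∀ x y, R x y → R y x := by
      rintro x y ⟨hx, hy, hxy⟩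
      refine ⟨hy, hx, ?_⟩
      unfold CellAdj at hxy ⊢
      omega
    have hrow : ∀ m i, (i, lam.rowLen i + m) ∈ nu.cells \ lam.cells →
        Relation.ReflTransGen R (i, lam.rowLen i + m) (i, lam.rowLen i) := by
      intro m i
      induction m with
      | zero => exact fun _ => Relation.ReflTransGen.refl
      | succ m ih =>
        intro hm
        have hm' : (i, lam.rowLen i + m) ∈ nu.cells \ lam.cells := by
          rw [mem_sdiff_iff] at hm ⊢
          omega
        refine Relation.ReflTransGen.head ⟨hm, hm', ?_⟩ (ih hm')
        exact Or.inl ⟨rfl, Or.inr rfl⟩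
    -- Every cell is connected to the tail: west to the start of its row, one step south, and so on.
    have hcell : ∀ i j, (i, j) ∈ nu.cells \ lam.cells →
        Relation.ReflTransGen R (i, j) (i, lam.rowLen i) := by
      intro i j hij
      have := hrow (j - lam.rowLen i) i
      rw [Nat.add_sub_cancel' (mem_sdiff_iff.1 hij).1] at this
      exact this hij
    have hdown : ∀ m i, t ≤ i → i + m = k →
        Relation.ReflTransGen R (i, lam.rowLen i) (k, lam.rowLen k) := by
      intro m
      induction m with
      | zero =>
        rintro i _ rfl
        exact Relation.ReflTransGen.refl
      | succ m ih =>
        intro i hti hik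
        have hmem : (i + 1, lam.rowLen i) ∈ nu.cells \ lam.cells := by
          rw [mem_sdiff_iff, h.succ i hti (by omega)]
          exact ⟨lam.rowLen_anti _ _ (Nat.le_succ i), Nat.lt_succ_self _⟩
        refine Relation.ReflTransGen.head ⟨h.left_mem hti (by omega), hmem, ?_⟩
          ((hcell _ _ hmem).trans (ih (i + 1) (by omega) (by omega)))
        exact Or.inr ⟨rfl, Or.inl rfl⟩
    have htail : ∀ a ∈ nu.cells \ lam.cells, Relation.ReflTransGen R a (k, lam.rowLen k) := by
      rintro ⟨i, j⟩ hij
      have hi := h.mem_rows hij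
      exact (hcell i j hij).trans (hdown (k - i) i hi.1 (by omega))
    have hrev : ∀ {x y}, Relation.ReflTransGen R x y → Relation.ReflTransGen R y x := by
      intro x y hxy
      induction hxy with
      | refl => exact Relation.ReflTransGen.refl
      | tail _ hbc ih => exact Relation.ReflTransGen.head (hsymm _ _ hbc) ih
    intro a ha b hb
    exact (htail a ha).trans (hrev (htail b hb))
  no_square := by
    rintro i j ⟨h1, -, -, h2⟩
    have hi1 := h.mem_rows h1
    have hi2 := h.mem_rows h2
    have := h.succ i hi1.1 (by omega)
    rw [mem_sdiff_iff] at h1 h2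
    omega

/-- By `card_add`, size and tail row fix the new position of the moved bead, hence the row in which
it lands; the remaining beads are those of `lam`. -/
theorem unique {nu' : YoungDiagram} {t' : ℕ} (h : RibbonRows lam nu t k)
    (h' : RibbonRows lam nu' t' k)
    (hc : (nu.cells \ lam.cells).card = (nu'.cells \ lam.cells).card) : nu = nu' := by
  have key : ∀ {nu nu' : YoungDiagram} {t t' : ℕ}, RibbonRows lam nu t k →
      RibbonRows lam nu' t' k →
      (nu.cells \ lam.cells).card = (nu'.cells \ lam.cells).card → t' ≤ t := by
    intro nu nu' t t' h h' hc
    by_contra! hlt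
    have e := h.card_add
    have e' := h'.card_add
    obtain ⟨u, rfl⟩ := Nat.exists_eq_add_one_of_ne_zero (by omega : t' ≠ 0)
    have hk := h'.le
    have h1 := h.succ u (by omega) (by omega)
    have h2 := h'.off u (by omega)
    have h3 := nu'.rowLen_anti u (u + 1) (Nat.le_succ u)
    have h4 := nu.rowLen_anti t (u + 1) hlt.le
    omega
  have htt : t = t' := le_antisymm (key h' h hc.symm) (key h h' hc)
  subst htt
  have e := h.card_add
  have e' := h'.card_add
  refine eq_of_rowLen_eq fun i => ?_
  by_cases hi : i < t ∨ k < i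
  · rw [h.off i hi, h'.off i hi]
  · rcases (not_lt.1 fun hh => hi (Or.inl hh)).eq_or_lt with rfl | hti
    · omega
    · obtain ⟨i, rfl⟩ := Nat.exists_eq_add_one_of_ne_zero (by omega : i ≠ 0)
      rw [h.succ i (by omega) (by omega), h'.succ i (by omega) (by omega)]

end RibbonRows

/-- An adjacency path that leaves the rows up to `i` crosses an edge between the rows
`i` and `i + 1`. -/
theorem exists_crossing {ξ : Finset (ℕ × ℕ)} {a b : ℕ × ℕ} {i : ℕ}
    (h : Relation.ReflTransGen (fun x y => x ∈ ξ ∧ y ∈ ξ ∧ CellAdj x y) a b)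
    (ha : a.1 ≤ i) (hb : i < b.1) : ∃ j, (i, j) ∈ ξ ∧ (i + 1, j) ∈ ξ := by
  induction h with
  | refl => omega
  | @tail b c _ hbc ih =>
    by_cases hi : i < b.1
    · exact ih hi
    · obtain ⟨hb', hc', hadj⟩ := hbc
      obtain ⟨b1, b2⟩ := b
      obtain ⟨c1, c2⟩ := c
      simp only [CellAdj] at *
      have e1 : b1 = i := by omega
      have e2 : c1 = i + 1 := by omega
      have e3 : c2 = b2 := by omega
      subst e1 e2 e3
      exact ⟨_, hb', hc'⟩

/-- Connectedness makes consecutive rows of the ribbon overlap in at least one column, and the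
absence of `2 × 2` squares in at most one. This is the equation `succ`. -/
theorem exists_ribbonRows {lam nu : YoungDiagram} (hle : lam ≤ nu)
    (hξ : IsRibbon (nu.cells \ lam.cells)) : ∃ t k, RibbonRows lam nu t k := by
  obtain ⟨⟨t, jt⟩, ht, htmin⟩ := Finset.exists_min_image _ Prod.fst hξ.nonempty
  obtain ⟨⟨k, jk⟩, hk, hkmax⟩ := Finset.exists_max_image _ Prod.fst hξ.nonempty
  refine ⟨t, k, hkmax _ ht, ?_, ?_, ?_⟩
  · intro i hi
    by_contra hne
    have hmem : (i, lam.rowLen i) ∈ nu.cells \ lam.cells :=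
      mem_sdiff_iff.2 ⟨le_rfl, lt_of_le_of_ne (rowLen_mono hle i) (Ne.symm hne)⟩
    have h1 := htmin _ hmem
    have h2 := hkmax _ hmem
    simp only at h1 h2
    omega
  · intro i hti hik
    obtain ⟨j, h1, h2⟩ := exists_crossing (i := i) (hξ.connected _ ht _ hk) hti hik
    have hns := hξ.no_square i (lam.rowLen i)
    simp only [mem_sdiff_iff] at h1 h2 hns
    have h3 := lam.rowLen_anti i (i + 1) (Nat.le_succ i)
    have h4 := nu.rowLen_anti i (i + 1) (Nat.le_succ i)
    omega
  · rw [mem_sdiff_iff] at ht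
    omega

/-- A ribbon of size `d` with its tail in row `k` can be added unless the position to which it
would move the bead of row `k` is that of another bead. -/
theorem exists_ribbonRows_of_ne (lam : YoungDiagram) (k d : ℕ) (hd : 0 < d)
    (h : ∀ i < k, lam.rowLen i + (k - i) ≠ lam.rowLen k + d) :
    ∃ nu t, RibbonRows lam nu t k ∧ (nu.cells \ lam.cells).card = d := by
  classical
  have hex : ∃ t, t ≤ k ∧ lam.rowLen t + (k - t) < lam.rowLen k + d := ⟨k, le_rfl, by omega⟩
  -- Row `t` is the northernmost one whose bead lies below the new position of the moved bead; the
  -- sorted moved bead lands there.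
  obtain ⟨t, ⟨htk, ht⟩, hmin⟩ : ∃ t, (t ≤ k ∧ lam.rowLen t + (k - t) < lam.rowLen k + d) ∧
      ∀ i < t, ¬(i ≤ k ∧ lam.rowLen i + (k - i) < lam.rowLen k + d) :=
    ⟨Nat.find hex, Nat.find_spec hex, fun i hi => Nat.find_min hex hi⟩
  -- The beads of rows `t, …, k - 1` slide down by one row, which lengthens each row by one. The
  -- subtraction of `k - t` is exact by `ht`.
  let r : ℕ → ℕ := fun i => if i < t ∨ k < i then lam.rowLen i
    else if i = t then lam.rowLen k + d - (k - t) else lam.rowLen (i - 1) + 1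
  have hr : Antitone r := by
    refine antitone_nat_of_succ_le fun i => ?_
    have h1 := lam.rowLen_anti i (i + 1) (Nat.le_succ i)
    have h2 := lam.rowLen_anti (i - 1) i (Nat.sub_le i 1)
    have h3 := h i
    have h4 := hmin i
    simp only [r, Nat.add_sub_cancel]
    split_ifs <;> try omega
    · have : i = k := by omega
      subst this
      have : i = t := by omega
      omega
    · have : i = t := by omega
      subst this
      omega
  obtain ⟨nu, hnu⟩ := exists_rowLen_eq r hr (max (lam.colLen 0) (k + 1)) (by
    intro i hi
    have h1 : k < i := by omega
    simp only [r, h1, or_true, if_true]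
    by_contra hne
    have : (i, 0) ∈ lam := YoungDiagram.mem_iff_lt_rowLen.2 (Nat.pos_of_ne_zero hne)
    rw [YoungDiagram.mem_iff_lt_colLen] at this
    omega)
  have hR : RibbonRows lam nu t k := by
    refine ⟨htk, fun i hi => ?_, fun i h1 h2 => ?_, ?_⟩
    · rw [hnu]
      simp only [r, if_pos hi]
    · rw [hnu]
      simp only [r, Nat.add_sub_cancel]
      rw [if_neg (by omega), if_neg (by omega)]
    · rw [hnu]
      simp only [r]
      rw [if_neg (by omega), if_pos trivial]
      omega
  refine ⟨nu, t, hR, ?_⟩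
  have e := hR.card_add
  rw [hnu] at e
  simp only [r] at e
  rw [if_neg (by omega), if_pos trivial] at e
  omega

/-- The exponents `λ + δ`. -/
def beads (N : ℕ) (lam : YoungDiagram) (i : Fin N) : ℕ := lam.rowLen i + (N - 1 - (i : ℕ))

/-- Adding a ribbon moves the bead of row `k` and then sorts: the cycle on rows `t, …, k` carries
the moved bead to row `t` and shifts the beads in between. Its sign is `(-1) ^ (k - t)`, the sign of
the ribbon. -/
theorem RibbonRows.beads_comp_cycleIcc {lam nu : YoungDiagram} {N t : ℕ} {k : Fin N}
    (h : RibbonRows lam nu t k) :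
    beads N nu ∘ Fin.cycleIcc ⟨t, h.le.trans_lt k.2⟩ k =
      beads N lam + Pi.single k (nu.cells \ lam.cells).card := by
  have : NeZero N := ⟨by have := k.2; omega⟩
  have hk := k.2
  have e := h.card_add
  have htk := h.le
  funext i
  simp only [Function.comp_apply, Pi.add_apply]
  rcases eq_or_ne i k with rfl | hik
  · rw [Pi.single_eq_same, Fin.cycleIcc_of_last (Fin.mk_le_of_le_val h.le)]
    simp only [beads]
    omega
  rw [Pi.single_eq_of_ne hik, add_zero]
  rcases lt_or_gt_of_ne hik with hlt | hgt
  · rcases lt_or_ge (i : ℕ) t with hit | hit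
    · rw [Fin.cycleIcc_of_lt (Fin.lt_def.2 hit)]
      simp only [beads, h.off i (Or.inl hit)]
    · rw [Fin.cycleIcc_of_ge_of_lt (Fin.mk_le_of_le_val hit) hlt]
      have hv : ((i + 1 : Fin N) : ℕ) = i + 1 := Fin.val_add_one_of_lt' (by
        have := Fin.lt_def.1 hlt
        omega)
      have := Fin.lt_def.1 hlt
      simp only [beads, hv]
      rw [h.succ i hit (Fin.lt_def.1 hlt)]
      omega
  · rw [Fin.cycleIcc_of_gt hgt]
    simp only [beads, h.off i (Or.inr (Fin.lt_def.1 hgt))]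

theorem RibbonRows.fillingSum_eq {ι : Type*} [Fintype ι] [DecidableEq ι] (b : ι → ℕ)
    {lam nu : YoungDiagram} {N t : ℕ} {k : Fin N} (h : RibbonRows lam nu t k) (S : Finset ι) :
    fillingSum b (k + 1) (beads N lam + Pi.single k (nu.cells \ lam.cells).card) S =
      ribbonSign (nu.cells \ lam.cells) • fillingSum b (k + 1) (beads N nu) S := by
  rw [← h.beads_comp_cycleIcc, fillingSum_comp_perm]
  · rw [Fin.sign_cycleIcc_of_le (Fin.mk_le_of_le_val h.le), ribbonSign, h.height_eq]
    simp
  · intro i hi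
    exact Fin.cycleIcc_of_gt (Fin.lt_def.2 hi)

/-! ### Adding and removing the last ribbon of a tiling -/

theorem IsRibbon.tail_mem {ξ : Finset (ℕ × ℕ)} (h : IsRibbon ξ) : tail ξ ∈ ξ := by
  obtain ⟨ρ, ν, hle, rfl⟩ := h.skew
  obtain ⟨t, k, hR⟩ := exists_ribbonRows hle h
  rw [hR.tail_eq]
  exact hR.left_mem hR.le le_rfl

namespace MonotonicTiling

theorem tail_mem_shape (T : MonotonicTiling) {ξ : Finset (ℕ × ℕ)} (hξ : ξ ∈ T.ribbons) :
    tail ξ ∈ T.shape :=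
  (T.cover _).2 ⟨ξ, hξ, (T.isRibbon ξ hξ).tail_mem⟩

/-- Removing the last ribbon of a tiling gives a tiling. -/
theorem exists_init (T : MonotonicTiling) {l : List (Finset (ℕ × ℕ))} {ξ : Finset (ℕ × ℕ)}
    (h : T.ribbons = l ++ [ξ]) : ∃ (T₀ : MonotonicTiling) (t k : ℕ), T₀.ribbons = l ∧
      RibbonRows T₀.shape T.shape t k ∧ ξ = T.shape.cells \ T₀.shape.cells := by
  obtain ⟨ν, hν⟩ := T.initial l.length (by simp [h])
  have hd := T.disjoint
  have ht := T.tails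
  rw [h] at hd ht
  have htake : ∀ i ≤ l.length, T.ribbons.take i = l.take i := fun i hi => by
    rw [h, List.take_append_of_le_length hi]
  have hν' : ∀ c, c ∈ ν ↔ ∃ η ∈ l, c ∈ η := by
    intro c
    rw [hν, htake _ le_rfl, List.take_length]
  let T₀ : MonotonicTiling :=
    { shape := ν
      ribbons := l
      isRibbon := fun η hη => T.isRibbon η (by simp [h, hη])
      disjoint := (List.pairwise_append.1 hd).1
      cover := hν'
      tails := (List.pairwise_append.1 ht).1
      initial := fun i hi => by
        rw [← htake i hi]
        exact T.initial i (by rw [h, List.length_append]; omega) }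
  have hcover : ∀ c, c ∈ T.shape ↔ c ∈ ν ∨ c ∈ ξ := by
    intro c
    rw [T.cover, hν', h]
    simp only [List.mem_append, List.mem_singleton]
    constructor
    · rintro ⟨η, hη | rfl, hc⟩
      exacts [Or.inl ⟨η, hη, hc⟩, Or.inr hc]
    · rintro (⟨η, hη, hc⟩ | hc)
      exacts [⟨η, Or.inl hη, hc⟩, ⟨ξ, Or.inr rfl, hc⟩]
  have hle : ν ≤ T.shape := fun c hc => (hcover c).2 (Or.inl hc)
  have hξ : ξ = T.shape.cells \ ν.cells := by
    ext c
    rw [Finset.mem_sdiff, YoungDiagram.mem_cells, YoungDiagram.mem_cells, hcover]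
    constructor
    · intro hc
      refine ⟨Or.inr hc, fun hcν => ?_⟩
      obtain ⟨η, hη, hcη⟩ := (hν' c).1 hcν
      exact Finset.disjoint_left.1 ((List.pairwise_append.1 hd).2.2 η hη ξ (by simp)) hcη hc
    · rintro ⟨h1 | h1, h2⟩
      exacts [absurd h1 h2, h1]
  have hr : IsRibbon (T.shape.cells \ ν.cells) := by
    rw [← hξ]
    exact T.isRibbon ξ (by simp [h])
  obtain ⟨t, k, hR⟩ := exists_ribbonRows hle hr
  exact ⟨T₀, t, k, rfl, hR, hξ⟩

/-- Ribbons with their tails strictly more to the east have tails weakly more to the north. -/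
theorem tail_row_le (T : MonotonicTiling) {l : List (Finset (ℕ × ℕ))} {ξ : Finset (ℕ × ℕ)}
    (h : T.ribbons = l ++ [ξ]) : ∀ η ∈ l, (tail ξ).1 ≤ (tail η).1 := by
  induction l using List.reverseRecOn generalizing T ξ with
  | nil => simp
  | append_singleton l ξ₀ ih =>
    obtain ⟨T₀, t, k, h₀, hR, hξ⟩ := T.exists_init h
    obtain ⟨T₁, t₁, k₁, h₁, hR₁, hξ₀⟩ := T₀.exists_init h₀
    have hk : (tail ξ).1 ≤ (tail ξ₀).1 := by
      have ht := T.tails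
      rw [h] at ht
      have hlt := (List.pairwise_append.1 ht).2.2 ξ₀ (by simp) ξ (by simp)
      rw [hξ, hξ₀, hR.tail_eq, hR₁.tail_eq] at hlt ⊢
      simp only at hlt ⊢
      -- If the new tail were strictly south of the previous one, at row `k > k₁`, its column would
      -- be at most the length of row `k₁ + 1`. The previous ribbon leaves that row unchanged, so
      -- this length is at most the column of the previous tail.
      by_contra! hkk
      have h1 := T₀.shape.rowLen_anti (k₁ + 1) k hkk
      have h2 := hR₁.off (k₁ + 1) (Or.inr (Nat.lt_succ_self _))
      have h3 := T₁.shape.rowLen_anti k₁ (k₁ + 1) (Nat.le_succ _)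
      omega
    intro η hη
    rcases List.mem_append.1 hη with hη | hη
    · exact hk.trans (ih T₀ h₀ η hη)
    · rw [List.mem_singleton.1 hη]
      exact hk

/-- The new tail sits just east of row `k` of the old shape. An old tail in a row weakly south of
row `k` lies in that shape, so its column is already occupied in row `k` and is strictly to the
west. -/
theorem exists_snoc (T : MonotonicTiling) {nu : YoungDiagram} {t k : ℕ}
    (hR : RibbonRows T.shape nu t k) (hk : ∀ ξ ∈ T.ribbons, k ≤ (tail ξ).1) :
    ∃ T' : MonotonicTiling, T'.shape = nu ∧
      T'.ribbons = T.ribbons ++ [nu.cells \ T.shape.cells] := by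
  have hcov : ∀ c, c ∈ nu ↔ ∃ ξ ∈ T.ribbons ++ [nu.cells \ T.shape.cells], c ∈ ξ := by
    intro c
    have h1 : c ∈ nu ↔ c ∈ T.shape ∨ c ∈ nu.cells \ T.shape.cells := by
      rw [Finset.mem_sdiff, YoungDiagram.mem_cells, YoungDiagram.mem_cells]
      have := fun h : c ∈ T.shape => hR.lam_le h
      tauto
    rw [h1, T.cover]
    simp only [List.mem_append, List.mem_singleton]
    constructor
    · rintro (⟨η, hη, hc⟩ | hc)
      exacts [⟨η, Or.inl hη, hc⟩, ⟨_, Or.inr rfl, hc⟩]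
    · rintro ⟨η, hη | rfl, hc⟩
      exacts [Or.inl ⟨η, hη, hc⟩, Or.inr hc]
  refine ⟨{ shape := nu
            ribbons := T.ribbons ++ [nu.cells \ T.shape.cells]
            isRibbon := ?_
            disjoint := ?_
            cover := hcov
            tails := ?_
            initial := ?_ }, rfl, rfl⟩
  · intro ξ hξ
    rcases List.mem_append.1 hξ with hξ | hξ
    · exact T.isRibbon ξ hξ
    · rw [List.mem_singleton.1 hξ]
      exact hR.isRibbon
  · refine List.pairwise_append.2 ⟨T.disjoint, List.pairwise_singleton _ _, ?_⟩
    intro ξ hξ η hη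
    rw [List.mem_singleton.1 hη, Finset.disjoint_left]
    intro c hc hc'
    exact (Finset.mem_sdiff.1 hc').2 ((T.cover c).2 ⟨ξ, hξ, hc⟩)
  · refine List.pairwise_append.2 ⟨T.tails, List.pairwise_singleton _ _, ?_⟩
    intro ξ hξ η hη
    rw [List.mem_singleton.1 hη, hR.tail_eq]
    exact YoungDiagram.mem_iff_lt_rowLen.1
      (T.shape.up_left_mem (hk ξ hξ) le_rfl (T.tail_mem_shape hξ))
  · intro i hi
    rw [List.length_append, List.length_singleton] at hi
    rcases hi.eq_or_lt with rfl | hi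
    · refine ⟨nu, fun c => ?_⟩
      rw [hcov, List.take_of_length_le (by simp)]
    · rw [List.take_append_of_le_length (Nat.lt_succ_iff.1 hi)]
      exact T.initial i (Nat.lt_succ_iff.1 hi)

end MonotonicTiling

/-! ### Tilings whose ribbons are labelled -/

/-- A monotonic tiling with distinct labels on its ribbons, the label `s` being reserved for
ribbons of size `b s`. -/
def LabelledTiling {ι : Type*} (b : ι → ℕ) : Type _ :=
  {p : MonotonicTiling × List ι // p.2.Nodup ∧ p.2.map b = p.1.type}

namespace LabelledTiling

variable {ι : Type*} {b : ι → ℕ}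

def tiling (p : LabelledTiling b) : MonotonicTiling := p.1.1

def labels (p : LabelledTiling b) : List ι := p.1.2

theorem nodup (p : LabelledTiling b) : p.labels.Nodup := p.2.1

theorem map_labels (p : LabelledTiling b) : p.labels.map b = p.tiling.type := p.2.2

theorem ext {p q : LabelledTiling b} (h1 : p.tiling.ribbons = q.tiling.ribbons)
    (h2 : p.labels = q.labels) : p = q :=
  Subtype.ext (Prod.ext (MonotonicTiling.ext_ribbons h1) h2)

theorem length_eq (p : LabelledTiling b) : p.labels.length = p.tiling.ribbons.length := by
  have := congrArg List.length p.map_labels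
  simpa [MonotonicTiling.type] using this

/-- All tails lie in rows of index at least `k`. -/
def TailsFrom (k : ℕ) (p : LabelledTiling b) : Prop := ∀ ξ ∈ p.tiling.ribbons, k ≤ (tail ξ).1

/-- `q` arises from `p` by adding a last ribbon with label `s` and with its tail in row `k`. -/
structure Snoc (k : ℕ) (p : LabelledTiling b) (s : ι) (q : LabelledTiling b) : Prop where
  labels_eq : q.labels = p.labels ++ [s]
  ribbons_eq : q.tiling.ribbons =
    p.tiling.ribbons ++ [q.tiling.shape.cells \ p.tiling.shape.cells]
  rows : ∃ t, RibbonRows p.tiling.shape q.tiling.shape t k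

namespace Snoc

variable {k : ℕ} {p q : LabelledTiling b} {s : ι}

theorem card_eq (h : Snoc k p s q) :
    (q.tiling.shape.cells \ p.tiling.shape.cells).card = b s := by
  have h1 := q.map_labels
  rw [h.labels_eq, MonotonicTiling.type, h.ribbons_eq, List.map_append, List.map_append,
    p.map_labels] at h1
  have h2 := List.append_cancel_left h1
  simpa using h2.symm

theorem tailsFrom (h : Snoc k p s q) : TailsFrom k q ↔ TailsFrom k p := by
  obtain ⟨t, hR⟩ := h.rows
  unfold TailsFrom
  rw [h.ribbons_eq]
  simp only [List.mem_append, List.mem_singleton]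
  constructor
  · exact fun hq ξ hξ => hq ξ (Or.inl hξ)
  · rintro hp ξ (hξ | rfl)
    · exact hp ξ hξ
    · rw [hR.tail_eq]

theorem not_tailsFrom (h : Snoc k p s q) : ¬TailsFrom (k + 1) q := by
  obtain ⟨t, hR⟩ := h.rows
  intro hq
  have h1 := hq (q.tiling.shape.cells \ p.tiling.shape.cells) (by rw [h.ribbons_eq]; simp)
  rw [hR.tail_eq] at h1
  simp only at h1
  omega

theorem left_unique {p' : LabelledTiling b} {s' : ι} (h : Snoc k p s q) (h' : Snoc k p' s' q) :
    p = p' ∧ s = s' := by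
  have h1 := List.append_inj' (h.labels_eq.symm.trans h'.labels_eq) rfl
  have h2 := List.append_inj' (h.ribbons_eq.symm.trans h'.ribbons_eq) rfl
  exact ⟨ext h2.1 h1.1, by simpa using h1.2⟩

/-- The label gives the size of the new ribbon, and size and tail row determine it. -/
theorem right_unique {q' : LabelledTiling b} (h : Snoc k p s q) (h' : Snoc k p s q') :
    q = q' := by
  obtain ⟨t, hR⟩ := h.rows
  obtain ⟨t', hR'⟩ := h'.rows
  have hs := hR.unique hR' (h.card_eq.trans h'.card_eq.symm)
  refine ext ?_ (h.labels_eq.trans h'.labels_eq.symm)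
  rw [h.ribbons_eq, h'.ribbons_eq, hs]

end Snoc

theorem exists_init {k : ℕ} (q : LabelledTiling b) (hq : TailsFrom k q)
    (hq' : ¬TailsFrom (k + 1) q) : ∃ p s, Snoc k p s q := by
  have hne : q.tiling.ribbons ≠ [] := by
    rintro h
    refine hq' fun ξ hξ => ?_
    rw [h] at hξ
    simp at hξ
  have hne' : q.labels ≠ [] := by
    rw [← List.length_pos_iff_ne_nil] at hne ⊢
    rwa [q.length_eq]
  obtain ⟨l, ξ, hl⟩ := List.eq_nil_or_concat q.tiling.ribbons |>.resolve_left hne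
  obtain ⟨m, s, hm⟩ := List.eq_nil_or_concat q.labels |>.resolve_left hne'
  rw [List.concat_eq_append] at hl hm
  obtain ⟨T₀, t, k', hT₀, hR, hξ⟩ := q.tiling.exists_init hl
  -- The last ribbon has the northernmost tail, and the northernmost tail of `q` lies exactly in row
  -- `k`.
  have hk : k' = k := by
    refine le_antisymm ?_ ?_
    · by_contra! hlt
      refine hq' fun η hη => ?_
      have h1 : k' ≤ (tail η).1 := by
        rw [hl] at hη
        rcases List.mem_append.1 hη with hη | hη
        · have := q.tiling.tail_row_le hl η hη
          rwa [hξ, hR.tail_eq] at this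
        · rw [List.mem_singleton.1 hη, hξ, hR.tail_eq]
      exact Nat.lt_of_lt_of_le hlt h1
    · have := hq ξ (by rw [hl]; simp)
      rwa [hξ, hR.tail_eq] at this
  subst hk
  have hnd := q.nodup
  have hmap := q.map_labels
  rw [hm] at hnd hmap
  rw [MonotonicTiling.type, hl, List.map_append, List.map_append] at hmap
  refine ⟨⟨(T₀, m), (List.nodup_append.1 hnd).1, ?_⟩, s, ⟨hm, ?_, t, hR⟩⟩
  · rw [MonotonicTiling.type, hT₀]
    exact (List.append_inj' hmap rfl).1
  · change q.tiling.ribbons = T₀.ribbons ++ [q.tiling.shape.cells \ T₀.shape.cells]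
    rw [hT₀, ← hξ, hl]

/-! ### Contributions of labelled tilings and the induction over the variables -/

variable [Fintype ι] [DecidableEq ι]

theorem card_shape_le (p : LabelledTiling b) : p.tiling.shape.card ≤ ∑ s, b s := by
  refine p.tiling.card_shape_le.trans ?_
  rw [← p.map_labels, ← List.sum_toFinset b p.nodup]
  exact Finset.sum_le_sum_of_subset (Finset.subset_univ _)

instance : Finite (LabelledTiling b) := by
  classical
  let B : Finset (ℕ × ℕ) := Finset.range (∑ s, b s) ×ˢ Finset.range (∑ s, b s)
  have hfin : {l : List {ξ : Finset (ℕ × ℕ) // ξ ∈ B.powerset} |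
      l.length ≤ Fintype.card ι}.Finite := List.finite_length_le _ _
  have hfin' : {l : List ι | l.length ≤ Fintype.card ι}.Finite := List.finite_length_le _ _
  have hinj : Function.Injective fun p : LabelledTiling b => (p.tiling.ribbons, p.labels) :=
    fun p q h => ext (Prod.ext_iff.1 h).1 (Prod.ext_iff.1 h).2
  refine (Set.finite_range_iff hinj).1
    (((hfin.image (List.map Subtype.val)).prod hfin').subset ?_)
  rintro _ ⟨p, rfl⟩
  have hlen : p.labels.length ≤ Fintype.card ι := p.nodup.length_le_card
  have hsub : ∀ ξ ∈ p.tiling.ribbons, ξ ∈ B.powerset := by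
    intro ξ hξ
    rw [Finset.mem_powerset]
    intro c hc
    have h := lt_card_of_mem p.tiling.shape c ((p.tiling.cover c).2 ⟨ξ, hξ, hc⟩)
    have hle := p.card_shape_le
    simp only [B, Finset.mem_product, Finset.mem_range]
    omega
  refine ⟨⟨p.tiling.ribbons.attachWith (· ∈ B.powerset) hsub, ?_, ?_⟩, hlen⟩
  · simpa [← p.length_eq] using hlen
  · simp

instance : Fintype (LabelledTiling b) := Fintype.ofFinite _

/-- The labels that are not used. -/
def free (p : LabelledTiling b) : Finset ι := p.labels.toFinsetᶜ

/-- The contribution of a labelled tiling when its free labels are used to fill the first `k`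
variables. -/
def contribution (N k : ℕ) (p : LabelledTiling b) : MvPolynomial (Fin N) ℂ :=
  p.tiling.sign • fillingSum b k (beads N p.tiling.shape) p.free

namespace Snoc

variable {k : ℕ} {p q : LabelledTiling b} {s : ι}

theorem mem_free (h : Snoc k p s q) : s ∈ p.free := by
  have h1 := q.nodup
  rw [h.labels_eq, List.nodup_append] at h1
  simp only [free, Finset.mem_compl, List.mem_toFinset]
  intro hs
  exact h1.2.2 s hs s (by simp) rfl

theorem free_eq (h : Snoc k p s q) : q.free = p.free.erase s := by
  ext x
  simp [free, h.labels_eq]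

theorem contribution_eq {N : ℕ} {k : Fin N} (h : Snoc k p s q) :
    p.tiling.sign • fillingSum b (k + 1) (beads N p.tiling.shape + Pi.single k (b s))
      (p.free.erase s) = contribution N (k + 1) q := by
  obtain ⟨t, hR⟩ := h.rows
  rw [← h.card_eq, hR.fillingSum_eq, contribution, h.free_eq, smul_smul]
  congr 1
  simp [MonotonicTiling.sign, h.ribbons_eq]

end Snoc

/-- A collision of the moved bead with the bead of a row above `k` would make the term vanish by
`fillingSum_eq_zero`. Without a collision the ribbon exists. -/
theorem exists_snoc {N : ℕ} (hb : ∀ s, 0 < b s) (k : Fin N) (p : LabelledTiling b)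
    (hp : TailsFrom k p) (s : ι) (hs : s ∈ p.free)
    (h0 : p.tiling.sign • fillingSum b (k + 1) (beads N p.tiling.shape + Pi.single k (b s))
      (p.free.erase s) ≠ 0) : ∃ q, Snoc k p s q := by
  have hk := k.2
  have hne : ∀ i < (k : ℕ), p.tiling.shape.rowLen i + (k - i) ≠
      p.tiling.shape.rowLen k + b s := by
    intro i hi he
    refine h0 ?_
    rw [fillingSum_eq_zero b _ _ _ (i := ⟨i, hi.trans k.2⟩) (j := k), smul_zero]
    · exact fun h => hi.ne (congrArg Fin.val h)
    · exact Nat.lt_succ_of_lt hi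
    · exact Nat.lt_succ_self _
    · simp only [Pi.add_apply, Pi.single_eq_same]
      rw [Pi.single_eq_of_ne fun h => hi.ne (congrArg Fin.val h)]
      simp only [beads]
      omega
  obtain ⟨nu, t, hR, hcard⟩ := exists_ribbonRows_of_ne p.tiling.shape k (b s) (hb s) hne
  obtain ⟨T', rfl, hT'⟩ := p.tiling.exists_snoc hR hp
  refine ⟨⟨(T', p.labels ++ [s]), ?_, ?_⟩, ⟨rfl, hT', t, hR⟩⟩
  · simp only [free, Finset.mem_compl, List.mem_toFinset] at hs
    exact List.nodup_append.2 ⟨p.nodup, by simp, by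
      rintro x hx y hy rfl
      simp only [List.mem_singleton] at hy
      exact hs (hy ▸ hx)⟩
  · simp [MonotonicTiling.type, hT', hcard, p.map_labels]

open Classical in
/-- The contributions of the tilings with tails in rows of index at least `k`. -/
def contributionSum (b : ι → ℕ) (N k : ℕ) : MvPolynomial (Fin N) ℂ :=
  ∑ p : LabelledTiling b with TailsFrom k p, contribution N k p

/-- The tilings with tails in rows `≥ k`, with free labels filling the first `k + 1` variables, are
summed in two ways. Splitting by whether a tail lies in row `k` gives the left side plus the tilings
that have such a tail. Splitting fillings by whether variable `k` is used gives the right side plus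
terms with one label placed on `k`. Adding a last ribbon with its tail in row `k` identifies the two
extra sums. -/
theorem contributionSum_succ {N : ℕ} (hb : ∀ s, 0 < b s) (k : Fin N) :
    contributionSum b N (k + 1) = contributionSum b N k := by
  classical
  have h1 : ∑ p : LabelledTiling b with TailsFrom k p, contribution N (k + 1) p =
      contributionSum b N (k + 1) +
      ∑ p : LabelledTiling b with TailsFrom k p ∧ ¬TailsFrom (k + 1) p,
        contribution N (k + 1) p := by
    rw [← Finset.sum_filter_add_sum_filter_not _ (TailsFrom (k + 1)), Finset.filter_filter,
      Finset.filter_filter]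
    congr 1
    refine Finset.sum_congr (Finset.filter_congr fun p _ => ?_) fun _ _ => rfl
    exact ⟨fun h => h.2, fun h => ⟨fun ξ hξ => (Nat.le_succ _).trans (h ξ hξ), h⟩⟩
  have h2 : ∑ p : LabelledTiling b with TailsFrom k p, contribution N (k + 1) p =
      contributionSum b N k +
      ∑ p : LabelledTiling b with TailsFrom k p, ∑ s ∈ p.free,
        p.tiling.sign • fillingSum b (k + 1) (beads N p.tiling.shape + Pi.single k (b s))
          (p.free.erase s) := by
    rw [contributionSum, ← Finset.sum_add_distrib]
    refine Finset.sum_congr rfl fun p _ => ?_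
    rw [contribution, contribution, fillingSum_succ, smul_add, Finset.smul_sum]
  have h3 : ∑ p : LabelledTiling b with TailsFrom k p, ∑ s ∈ p.free,
        p.tiling.sign • fillingSum b (k + 1) (beads N p.tiling.shape + Pi.single k (b s))
          (p.free.erase s) =
      ∑ p : LabelledTiling b with TailsFrom k p ∧ ¬TailsFrom (k + 1) p,
        contribution N (k + 1) p := by
    rw [Finset.sum_sigma']
    have hex : ∀ x ∈ (Finset.univ.filter fun p : LabelledTiling b => TailsFrom k p).sigma
        (fun p => p.free), x.1.tiling.sign • fillingSum b (k + 1)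
          (beads N x.1.tiling.shape + Pi.single k (b x.2)) (x.1.free.erase x.2) ≠ 0 →
        ∃ q, Snoc k x.1 x.2 q := by
      rintro ⟨p, s⟩ hx h0
      rw [Finset.mem_sigma, Finset.mem_filter] at hx
      exact exists_snoc hb k p hx.1.2 s hx.2 h0
    -- The correspondence exists only between nonzero terms: pairs `(p, s)` whose bead collides have
    -- no extension and contribute zero.
    refine Finset.sum_bij_ne_zero (fun x hx h0 => (hex x hx h0).choose) ?_ ?_ ?_ ?_
    · rintro x hx h0
      have hq := (hex x hx h0).choose_spec
      rw [Finset.mem_sigma, Finset.mem_filter] at hx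
      rw [Finset.mem_filter]
      exact ⟨Finset.mem_univ _, hq.tailsFrom.2 hx.1.2, hq.not_tailsFrom⟩
    · rintro ⟨p, s⟩ hx h0 ⟨p', s'⟩ hx' h0' he
      have hq := (hex _ hx h0).choose_spec
      rw [he] at hq
      obtain ⟨rfl, h⟩ := hq.left_unique (hex _ hx' h0').choose_spec
      simp only at h
      rw [h]
    · intro q hq h0
      rw [Finset.mem_filter] at hq
      obtain ⟨p, s, hs⟩ := exists_init q hq.2.1 hq.2.2
      have hx : (⟨p, s⟩ : Σ _ : LabelledTiling b, ι) ∈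
          (Finset.univ.filter fun p : LabelledTiling b => TailsFrom k p).sigma
            (fun p => p.free) := by
        rw [Finset.mem_sigma, Finset.mem_filter]
        exact ⟨⟨Finset.mem_univ _, hs.tailsFrom.1 hq.2.1⟩, hs.mem_free⟩
      have h0' := h0
      rw [← hs.contribution_eq] at h0'
      exact ⟨⟨p, s⟩, hx, h0', (hex _ hx h0').choose_spec.right_unique hs⟩
    · intro x hx h0
      exact (hex x hx h0).choose_spec.contribution_eq
  rw [h1, h3] at h2
  exact add_right_cancel h2

/-- No variable is left to fill, so only tilings that use every label survive. -/
theorem contributionSum_zero (N : ℕ) :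
    contributionSum b N 0 = ∑ p : LabelledTiling b with p.free = ∅,
      p.tiling.sign • alternant N fun i => p.tiling.shape.rowLen i := by
  classical
  rw [contributionSum, Finset.filter_true_of_mem fun p _ ξ _ => Nat.zero_le _, Finset.sum_filter]
  refine Finset.sum_congr rfl fun p _ => ?_
  rw [contribution, fillingSum_zero, alternant_eq_antisymmetrize]
  split_ifs
  · rfl
  · rw [smul_zero]

/-- A diagram with at most `N` cells has no cell in row `N` or further south, so only the empty
tiling, with all labels free, qualifies. -/
theorem contributionSum_top {N : ℕ} (hN : ∑ s, b s ≤ N) :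
    contributionSum b N N = fillingSum b N (fun i : Fin N => N - 1 - (i : ℕ)) Finset.univ := by
  classical
  let T : MonotonicTiling :=
    { shape := ⊥
      ribbons := []
      isRibbon := by simp
      disjoint := List.Pairwise.nil
      cover := by simp
      tails := List.Pairwise.nil
      initial := fun i _ => ⟨⊥, by simp⟩ }
  let p₀ : LabelledTiling b := ⟨(T, []), List.nodup_nil, rfl⟩
  have huniq : (Finset.univ.filter fun p : LabelledTiling b => TailsFrom N p) = {p₀} := by
    ext p
    rw [Finset.mem_filter, Finset.mem_singleton]
    constructor
    · rintro ⟨-, hp⟩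
      have hnil : p.tiling.ribbons = [] := by
        rw [List.eq_nil_iff_forall_not_mem]
        intro ξ hξ
        have h1 := (lt_card_of_mem _ _ (p.tiling.tail_mem_shape hξ)).1
        have h2 := p.card_shape_le
        have h3 := hp ξ hξ
        omega
      refine ext hnil ?_
      have := p.length_eq
      rw [hnil] at this
      exact List.length_eq_zero_iff.1 this
    · rintro rfl
      exact ⟨Finset.mem_univ _, fun ξ hξ => absurd hξ List.not_mem_nil⟩
  have hrow : ∀ i, (⊥ : YoungDiagram).rowLen i = 0 := by
    intro i
    by_contra hne
    exact YoungDiagram.notMem_bot (i, 0)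
      (YoungDiagram.mem_iff_lt_rowLen.2 (Nat.pos_of_ne_zero hne))
  have hbeads : beads N p₀.tiling.shape = fun i : Fin N => N - 1 - (i : ℕ) := by
    funext i
    change (⊥ : YoungDiagram).rowLen i + _ = _
    rw [hrow, zero_add]
  have hsign : p₀.tiling.sign = 1 := rfl
  have hfree : p₀.free = Finset.univ := by
    simp [free, labels, p₀]
  rw [contributionSum, huniq, Finset.sum_singleton, contribution, hbeads, hsign, hfree, one_smul]

end LabelledTiling

theorem fillingSum_univ_eq_sum_tilings {ι : Type*} [Fintype ι] [DecidableEq ι] {b : ι → ℕ}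
    (hb : ∀ s, 0 < b s) {N : ℕ} (hN : ∑ s, b s ≤ N) :
    fillingSum b N (fun i : Fin N => N - 1 - (i : ℕ)) Finset.univ =
      ∑ p : LabelledTiling b with p.free = ∅,
        p.tiling.sign • alternant N fun i => p.tiling.shape.rowLen i := by
  have h : ∀ k ≤ N, LabelledTiling.contributionSum b N k =
      LabelledTiling.contributionSum b N 0 := by
    intro k
    induction k with
    | zero => exact fun _ => rfl
    | succ k ih =>
      intro hk
      rw [← ih (by omega)]
      exact LabelledTiling.contributionSum_succ hb ⟨k, hk⟩
  rw [← LabelledTiling.contributionSum_top hN, h N le_rfl, LabelledTiling.contributionSum_zero]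

/-! ### Power sums in finitely many variables -/

/-- The power sum of the cycle type of `w` is the generating function of the colourings that
`w` preserves. -/
theorem psumPart_partition {α : Type*} [Fintype α] [DecidableEq α] {N : ℕ} (w : Equiv.Perm α) :
    MvPolynomial.psumPart (Fin N) ℂ w.partition =
      ∑ g : α → Fin N with g ∘ w = g, ∏ a, MvPolynomial.X (g a) := by
  classical
  let s := Equiv.Perm.SameCycle.setoid w
  let F : ℕ → MvPolynomial (Fin N) ℂ := MvPolynomial.psum (Fin N) ℂ
  let c : Quotient s → ℕ := fun q => (Finset.univ.filter fun a => Quotient.mk s a = q).card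
  -- Classes with `Φ q ≠ 1` are the nontrivial cycles, recorded by `cycleType`; the others are the
  -- fixed points, which `partition` adds as parts equal to `1`.
  let Φ : Quotient s → Equiv.Perm α := Quotient.lift (w.cycleOf) fun a b hab =>
    Equiv.Perm.SameCycle.cycleOf_eq hab
  have hΦ : ∀ a, Φ (Quotient.mk s a) = w.cycleOf a := fun a => rfl
  have hfix : ∀ a, Φ (Quotient.mk s a) = 1 ↔ a ∉ w.support := by
    intro a
    rw [hΦ, Equiv.Perm.cycleOf_eq_one_iff, Equiv.Perm.notMem_support]
  have hmk : ∀ a b, Quotient.mk s a = Quotient.mk s b ↔ w.SameCycle a b := fun a b =>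
    Quotient.eq (r := s)
  have h1 : ∏ q : Quotient s, F (c q) = MvPolynomial.psumPart (Fin N) ℂ w.partition := by
    rw [MvPolynomial.psumPart, Equiv.Perm.parts_partition, Multiset.map_add, Multiset.prod_add,
      ← Finset.prod_filter_mul_prod_filter_not Finset.univ (fun q => Φ q ≠ 1)]
    congr 1
    · rw [Equiv.Perm.cycleType_def, Multiset.map_map]
      change _ = ∏ σ ∈ w.cycleFactorsFinset, F σ.support.card
      refine Finset.prod_bij (fun q _ => Φ q) ?_ ?_ ?_ ?_
      · intro q
        induction q using Quotient.inductionOn with | _ a =>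
        intro hq
        rw [Finset.mem_filter, Ne, hfix, not_not] at hq
        exact Equiv.Perm.cycleOf_mem_cycleFactorsFinset_iff.2 hq.2
      · intro q hq q' hq' he
        induction q using Quotient.inductionOn with | _ a =>
        induction q' using Quotient.inductionOn with | _ a' =>
        rw [Finset.mem_filter, Ne, hfix, not_not] at hq hq'
        rw [hmk]
        exact (Equiv.Perm.sameCycle_iff_cycleOf_eq_of_mem_support hq.2 hq'.2).2 he
      · intro σ hσ
        have hcyc := (Equiv.Perm.mem_cycleFactorsFinset_iff.1 hσ).1
        obtain ⟨a, ha⟩ := hcyc.nonempty_support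
        refine ⟨Quotient.mk s a, ?_, (Equiv.Perm.cycle_is_cycleOf ha hσ).symm⟩
        rw [Finset.mem_filter, Ne, hfix, not_not]
        exact ⟨Finset.mem_univ _, Equiv.Perm.mem_cycleFactorsFinset_support_le hσ ha⟩
      · intro q
        induction q using Quotient.inductionOn with | _ a =>
        intro hq
        rw [Finset.mem_filter, Ne, hfix, not_not] at hq
        refine congrArg F (congrArg Finset.card ?_)
        ext y
        rw [Finset.mem_filter, hΦ, Equiv.Perm.mem_support_cycleOf_iff, hmk,
          Equiv.Perm.sameCycle_comm]
        simp [hq.2]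
    · rw [Multiset.map_replicate, Multiset.prod_replicate, ← Finset.card_compl,
        ← Finset.prod_const]
      symm
      refine Finset.prod_bij (fun a _ => Quotient.mk s a) ?_ ?_ ?_ ?_
      · intro a ha
        rw [Finset.mem_compl, ← hfix] at ha
        simpa using ha
      · intro a ha b hb hab
        rw [hmk] at hab
        rw [Finset.mem_compl, Equiv.Perm.notMem_support] at ha
        exact (Equiv.Perm.SameCycle.eq_of_left hab ha)
      · intro q
        induction q using Quotient.inductionOn with | _ a =>
        intro hq
        rw [Finset.mem_filter, not_not, hfix] at hq
        exact ⟨a, Finset.mem_compl.2 hq.2, rfl⟩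
      · intro a ha
        rw [Finset.mem_compl, Equiv.Perm.notMem_support] at ha
        have : c (Quotient.mk s a) = 1 := by
          rw [Finset.card_eq_one]
          refine ⟨a, ?_⟩
          ext y
          rw [Finset.mem_filter, Finset.mem_singleton, hmk]
          constructor
          · rintro ⟨-, h⟩
            exact (Equiv.Perm.SameCycle.eq_of_left h.symm ha).symm
          · rintro rfl
            exact ⟨Finset.mem_univ _, Equiv.Perm.SameCycle.refl _ _⟩
        rw [this]
  have hpow : ∀ g : α → Fin N, g ∘ w = g → ∀ a b, w.SameCycle a b → g a = g b := by
    intro g hg a b hab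
    obtain ⟨i, rfl⟩ := hab.exists_nat_pow_eq
    induction i with
    | zero => rfl
    | succ i ih =>
      rw [ih ⟨i, by simp⟩, pow_succ', Equiv.Perm.mul_apply]
      exact (congrFun hg _).symm
  rw [← h1]
  simp only [F, MvPolynomial.psum]
  -- Expanding the product of power sums chooses one variable per cycle, that is, a colouring
  -- constant on cycles.
  rw [Finset.prod_univ_sum, Fintype.piFinset_univ]
  refine Finset.sum_bij (fun h _ a => h (Quotient.mk s a)) ?_ ?_ ?_ ?_
  · intro h _
    rw [Finset.mem_filter]
    refine ⟨Finset.mem_univ _, ?_⟩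
    funext a
    simp only [Function.comp_apply]
    congr 1
    rw [hmk]
    exact ⟨-1, by simp⟩
  · intro h _ h' _ he
    funext q
    induction q using Quotient.inductionOn with | _ a =>
    exact congrFun he a
  · intro g hg
    rw [Finset.mem_filter] at hg
    exact ⟨Quotient.lift g fun a b hab => hpow g hg.2 a b hab, Finset.mem_univ _, rfl⟩
  · intro h _
    rw [← Finset.prod_fiberwise Finset.univ (Quotient.mk s)]
    refine Finset.prod_congr rfl fun q _ => ?_
    rw [Finset.prod_congr rfl (g := fun _ => MvPolynomial.X (h q)), Finset.prod_const]
    intro a ha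
    exact congrArg _ (congrArg h (Finset.mem_filter.1 ha).2)

/-! ### Truncation to finitely many variables -/

/-- `F` specializes to `p` when the variables of index at least `N` are set to zero. -/
def AgreeBelow (N : ℕ) (F : MvPowerSeries ℕ ℂ) (p : MvPolynomial (Fin N) ℂ) : Prop :=
  ∀ m : ℕ →₀ ℕ, (∀ i, N ≤ i → m i = 0) → MvPowerSeries.coeff m F =
    MvPolynomial.coeff m (MvPolynomial.rename (fun i : Fin N => (i : ℕ)) p)

namespace AgreeBelow

variable {N : ℕ}

theorem one : AgreeBelow N 1 1 := by
  intro m _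
  classical
  rw [map_one (MvPolynomial.rename _), MvPowerSeries.coeff_one, MvPolynomial.coeff_one]
  simp only [eq_comm]

theorem mul {F G : MvPowerSeries ℕ ℂ} {p q : MvPolynomial (Fin N) ℂ} (h : AgreeBelow N F p)
    (h' : AgreeBelow N G q) : AgreeBelow N (F * G) (p * q) := by
  classical
  intro m hm
  rw [map_mul (MvPolynomial.rename _), MvPowerSeries.coeff_mul, MvPolynomial.coeff_mul]
  refine Finset.sum_congr rfl fun x hx => ?_
  rw [Finset.HasAntidiagonal.mem_antidiagonal] at hx
  rw [h, h']
  · intro i hi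
    have := hm i hi
    rw [← hx, Finsupp.add_apply] at this
    omega
  · intro i hi
    have := hm i hi
    rw [← hx, Finsupp.add_apply] at this
    omega

theorem sum {κ : Type*} (s : Finset κ) {F : κ → MvPowerSeries ℕ ℂ}
    {p : κ → MvPolynomial (Fin N) ℂ} (h : ∀ x ∈ s, AgreeBelow N (F x) (p x)) :
    AgreeBelow N (∑ x ∈ s, F x) (∑ x ∈ s, p x) := by
  intro m hm
  rw [map_sum, map_sum, MvPolynomial.coeff_sum]
  exact Finset.sum_congr rfl fun x hx => h x hx m hm

theorem smul {F : MvPowerSeries ℕ ℂ} {p : MvPolynomial (Fin N) ℂ} (h : AgreeBelow N F p)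
    (z : ℂ) : AgreeBelow N (z • F) (z • p) := by
  intro m hm
  rw [map_smul, map_smul, h m hm, MvPolynomial.coeff_smul]

theorem zsmul {F : MvPowerSeries ℕ ℂ} {p : MvPolynomial (Fin N) ℂ} (h : AgreeBelow N F p)
    (z : ℤ) : AgreeBelow N (z • F) (z • p) := by
  intro m hm
  rw [map_zsmul, map_zsmul, h m hm, MvPolynomial.coeff_smul]

theorem nsmul {F : MvPowerSeries ℕ ℂ} {p : MvPolynomial (Fin N) ℂ} (h : AgreeBelow N F p)
    (z : ℕ) : AgreeBelow N (z • F) (z • p) := by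
  intro m hm
  rw [map_nsmul, map_nsmul, h m hm, MvPolynomial.coeff_smul]

/-- Positivity matters: for `d = 0` the series is `1`, while the polynomial is `N`. -/
theorem powerSum {d : ℕ} (hd : 0 < d) :
    AgreeBelow N (powerSum d) (MvPolynomial.psum (Fin N) ℂ d) := by
  classical
  intro m hm
  have hL : MvPowerSeries.coeff m (PathMN.powerSum d) =
      if ∃ i : ℕ, m = Finsupp.single i d then 1 else 0 := by
    change PathMN.powerSum d m = _
    unfold PathMN.powerSum
    congr
  rw [hL, MvPolynomial.psum, map_sum, MvPolynomial.coeff_sum]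
  simp only [map_pow, MvPolynomial.rename_X, MvPolynomial.coeff_X_pow]
  split_ifs with h
  · obtain ⟨i, rfl⟩ := h
    have hi : i < N := by
      by_contra! hi
      have := hm i hi
      rw [Finsupp.single_eq_same] at this
      omega
    rw [Finset.sum_eq_single ⟨i, hi⟩]
    · simp
    · intro j _ hj
      rw [if_neg]
      rw [Finsupp.single_left_inj hd.ne']
      exact fun h => hj (Fin.ext h)
    · simp
  · symm
    refine Finset.sum_eq_zero fun i _ => if_neg fun hi => h ⟨i, hi.symm⟩

theorem powerSumPart {n : ℕ} (ν : n.Partition) :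
    AgreeBelow N (powerSumPart ν) (MvPolynomial.psumPart (Fin N) ℂ ν) := by
  have key : ∀ s : Multiset ℕ, (∀ d ∈ s, 0 < d) →
      AgreeBelow N (s.map PathMN.powerSum).prod (s.map (MvPolynomial.psum (Fin N) ℂ)).prod := by
    intro s
    induction s using Multiset.induction_on with
    | empty => exact fun _ => by simpa using one
    | cons d s ih =>
      intro hs
      rw [Multiset.map_cons, Multiset.map_cons, Multiset.prod_cons, Multiset.prod_cons]
      exact (powerSum (hs d (by simp))).mul (ih fun e he => hs e (by simp [he]))
  exact key ν.parts fun d hd => ν.parts_pos hd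

theorem schur (lam : YoungDiagram) (h : lam.colLen 0 ≤ N) :
    AgreeBelow N (schur lam) (schurPoly N lam) := fun m hm => coeff_schur lam m N h hm

end AgreeBelow

/-! ### Atomic symmetric functions as sums over permutations -/

/-- Cycle types are invariant under conjugation, so each of the `n!` conjugates in the Reynolds
average contributes the same sum. -/
theorem atomic_eq_sum {n : ℕ} (P : PartialPerm n) :
    atomic P = ∑ w : Equiv.Perm (Fin n), P.indicator w • powerSumPart w.partition := by
  have hn : (n ! : ℂ) ≠ 0 := Nat.cast_ne_zero.2 (Nat.factorial_ne_zero n)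
  have hconj : ∀ v : Equiv.Perm (Fin n),
      ∑ w : Equiv.Perm (Fin n), P.indicator (v⁻¹ * w * v) • powerSumPart w.partition =
        ∑ w : Equiv.Perm (Fin n), P.indicator w • powerSumPart w.partition := by
    intro v
    refine Fintype.sum_equiv ((Equiv.mulLeft v⁻¹).trans (Equiv.mulRight v)) _ _ fun w => ?_
    have : IsConj w (v⁻¹ * w * v) := isConj_iff.2 ⟨v⁻¹, by simp⟩
    rw [Equiv.Perm.partition_eq_of_isConj] at this
    simp only [Equiv.trans_apply, Equiv.coe_mulLeft, Equiv.coe_mulRight]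
    rw [this]
  unfold atomic frobeniusChar reynolds
  rw [smul_smul, mul_one_div_cancel hn, one_smul]
  simp only [mul_smul, Finset.sum_smul, Finset.smul_sum]
  rw [Finset.sum_comm]
  simp only [← Finset.smul_sum]
  simp only [hconj]
  have hcard : (Finset.univ : Finset (Equiv.Perm (Fin n))).card = n ! := by
    rw [Finset.card_univ, Fintype.card_perm, Fintype.card_fin]
  rw [Finset.sum_const, hcard, ← Nat.cast_smul_eq_nsmul ℂ, smul_smul, one_div,
    inv_mul_cancel₀ hn, one_smul]

/-! ### Path power sums in finitely many variables -/

/-- The sum over `f` is a symmetric polynomial, so it can be moved inside the antisymmetrization,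
where it multiplies `x^δ`. -/
theorem alternant_zero_mul_sum {ι : Type*} [Fintype ι] [DecidableEq ι] (b : ι → ℕ) (N : ℕ) :
    alternant N 0 * ∑ f : ι → Fin N, (∏ i, (Fintype.card {s // f s = i})!) •
        ∏ s, (MvPolynomial.X (f s) : MvPolynomial (Fin N) ℂ) ^ b s =
      fillingSum b N (fun i : Fin N => N - 1 - (i : ℕ)) Finset.univ := by
  classical
  let wt : (ι → Fin N) → ℕ := fun f => ∏ i, (Fintype.card {s // f s = i})!
  have hR : fillingSum b N (fun i : Fin N => N - 1 - (i : ℕ)) Finset.univ =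
      ∑ f : ι → Fin N, wt f • antisymmetrize
        ((fun i : Fin N => N - 1 - (i : ℕ)) + fun i => ∑ s with f s = i, b s) := by
    symm
    refine Finset.sum_bij (fun f _ s => some (f s)) ?_ ?_ ?_ ?_
    · intro f _
      rw [mem_fillings]
      exact fun s => ⟨fun h => absurd (Finset.mem_univ s) h, fun _ => ⟨f s, (f s).2, rfl⟩⟩
    · intro f _ g _ h
      funext s
      exact Option.some_injective _ (congrFun h s)
    · intro g hg
      rw [mem_fillings] at hg
      choose f hf using fun s => (hg s).2 (Finset.mem_univ s)
      exact ⟨f, Finset.mem_univ _, funext fun s => (hf s).2.symm⟩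
    · intro f _
      have h1 : orderings (fun s => some (f s)) = wt f := by
        simp only [wt, orderings, Option.some_inj, Fintype.card_subtype]
      have h2 : load b (fun s => some (f s)) = fun i => ∑ s with f s = i, b s := by
        funext i
        simp only [load, Option.some_inj]
      rw [h1, h2]
  have hwt : ∀ (w : Equiv.Perm (Fin N)) (f : ι → Fin N), wt (w ∘ f) = wt f := by
    intro w f
    simp only [wt]
    rw [← Equiv.prod_comp w]
    simp
  have hload : ∀ f : ι → Fin N, (∏ i : Fin N, (MvPolynomial.X i : MvPolynomial (Fin N) ℂ) ^
      (∑ s with f s = i, b s)) = ∏ s, MvPolynomial.X (f s) ^ b s := by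
    intro f
    rw [← Finset.prod_fiberwise Finset.univ f]
    refine Finset.prod_congr rfl fun i _ => ?_
    rw [← Finset.prod_pow_eq_pow_sum]
    refine Finset.prod_congr rfl fun s hs => ?_
    rw [(Finset.mem_filter.1 hs).2]
  rw [hR, alternant, Finset.sum_mul]
  simp only [antisymmetrize, Finset.smul_sum]
  rw [Finset.sum_comm]
  refine Finset.sum_congr rfl fun w _ => ?_
  -- Replacing `f` by `w ∘ f` keeps its weight and matches the monomial with its image under `w`.
  rw [Finset.mul_sum, ← Equiv.sum_comp (Equiv.arrowCongr (Equiv.refl ι) w)]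
  refine Finset.sum_congr rfl fun f _ => ?_
  have h1 : wt (Equiv.arrowCongr (Equiv.refl ι) w f) = wt f := hwt w f
  change _ * wt _ • _ = _
  rw [h1]
  simp only [Pi.add_apply, Pi.zero_apply, zero_add, pow_add, Finset.prod_mul_distrib, map_mul,
    hload]
  rw [map_prod (MvPolynomial.rename w)
    (fun s => (MvPolynomial.X (f s) : MvPolynomial (Fin N) ℂ) ^ b s)]
  simp only [map_pow, MvPolynomial.rename_X, Equiv.arrowCongr_apply, Equiv.coe_refl,
    Equiv.refl_symm, Function.comp_apply, id_eq]
  rw [mul_smul_comm, smul_mul_assoc]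

/-- After exchanging the sums, the permutations fixing `f` are the independent permutations of its
fibres. -/
theorem sum_perm_eq_sum_factorial {ι : Type*} [Fintype ι] [DecidableEq ι] (b : ι → ℕ) (N : ℕ) :
    ∑ σ : Equiv.Perm ι, ∑ f : ι → Fin N with f ∘ σ = f,
        ∏ s, (MvPolynomial.X (f s) : MvPolynomial (Fin N) ℂ) ^ b s =
      ∑ f : ι → Fin N, (∏ i, (Fintype.card {s // f s = i})!) • ∏ s, MvPolynomial.X (f s) ^ b s := by
  classical
  simp only [Finset.sum_filter]
  rw [Finset.sum_comm]
  refine Finset.sum_congr rfl fun f _ => ?_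
  rw [← Finset.sum_filter, Finset.sum_const]
  congr 1
  rw [← DomMulAct.stabilizer_card f, Fintype.card_subtype]

/-- The permutation that joins the ends of directed paths to their starts as `σ` prescribes. -/
def joinPaths {r : ℕ} {b : Fin r → ℕ} (hb : ∀ i, 0 < b i) (σ : Equiv.Perm (Fin r)) :
    Equiv.Perm (Σ i, Fin (b i)) :=
  Equiv.ofBijective (fun x => if h : (x.2 : ℕ) + 1 < b x.1 then ⟨x.1, ⟨x.2 + 1, h⟩⟩
    else ⟨σ x.1, ⟨0, hb _⟩⟩) <| by
    refine Finite.injective_iff_bijective.1 ?_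
    rintro ⟨i, x⟩ ⟨j, y⟩ h
    have hx := x.2
    have hy := y.2
    simp only at h
    split_ifs at h with h1 h2 h2
    · simp only [Sigma.mk.injEq] at h
      obtain ⟨rfl, h⟩ := h
      simp only [heq_eq_eq, Fin.mk.injEq, add_left_inj] at h
      rw [Fin.ext h]
    · simp only [Sigma.mk.injEq] at h
      obtain ⟨rfl, h⟩ := h
      simp at h
    · simp only [Sigma.mk.injEq] at h
      obtain ⟨rfl, h⟩ := h
      simp at h
    · simp only [Sigma.mk.injEq, EmbeddingLike.apply_eq_iff_eq] at h
      obtain ⟨rfl, -⟩ := h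
      have : x = y := Fin.ext (by omega)
      rw [this]

/-! ### Permutations extending a disjoint union of directed paths -/

section JoinPaths

variable {r : ℕ} {b : Fin r → ℕ} (hb : ∀ i, 0 < b i)

theorem joinPaths_of_lt (σ : Equiv.Perm (Fin r)) (i : Fin r) (a : ℕ) (h : a + 1 < b i) :
    joinPaths hb σ ⟨i, ⟨a, by omega⟩⟩ = ⟨i, ⟨a + 1, h⟩⟩ := by
  simp [joinPaths, h]

theorem joinPaths_last (σ : Equiv.Perm (Fin r)) (i : Fin r) :
    joinPaths hb σ ⟨i, ⟨b i - 1, Nat.sub_lt (hb i) one_pos⟩⟩ = ⟨σ i, ⟨0, hb _⟩⟩ := by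
  have h : ¬b i - 1 + 1 < b i := by omega
  simp [joinPaths, h]

theorem joinPaths_injective : Function.Injective (joinPaths hb) := by
  intro σ τ h
  ext i
  have h1 := joinPaths_last hb σ i
  rw [h, joinPaths_last] at h1
  rw [(Sigma.mk.inj_iff.1 h1).1]

theorem exists_joinPaths_iff (w : Equiv.Perm (Σ i, Fin (b i))) :
    (∃ σ, joinPaths hb σ = w) ↔
      ∀ x y : Σ i, Fin (b i), x.1 = y.1 ∧ (x.2 : ℕ) + 1 = y.2 → w x = y := by
  constructor
  · rintro ⟨σ, rfl⟩ ⟨i, x⟩ ⟨j, y⟩ ⟨h1, h2⟩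
    simp only at h1 h2
    subst h1
    rw [joinPaths_of_lt hb σ i x (by rw [h2]; exact y.2)]
    congr 1
    exact Fin.ext h2
  · intro h
    -- The end of a path must map to a start, since every other vertex is already the image of its
    -- predecessor.
    have hlast : ∀ i, ∃ j, w ⟨i, ⟨b i - 1, Nat.sub_lt (hb i) one_pos⟩⟩ = ⟨j, ⟨0, hb j⟩⟩ := by
      intro i
      rcases hw : w ⟨i, ⟨b i - 1, Nat.sub_lt (hb i) one_pos⟩⟩ with ⟨j, ⟨a, ha⟩⟩
      refine ⟨j, ?_⟩
      rcases Nat.eq_zero_or_pos a with rfl | hpos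
      · rfl
      · have h1 := h ⟨j, ⟨a - 1, by omega⟩⟩ ⟨j, ⟨a, ha⟩⟩ ⟨rfl, by simp only; omega⟩
        rw [← hw, EmbeddingLike.apply_eq_iff_eq] at h1
        obtain ⟨rfl, h2⟩ := Sigma.mk.inj_iff.1 h1
        simp only [heq_eq_eq, Fin.mk.injEq] at h2
        omega
    choose σ hσ using hlast
    have hinj : Function.Injective σ := by
      intro i j hij
      have h1 := hσ i
      rw [hij, ← hσ j, EmbeddingLike.apply_eq_iff_eq] at h1
      exact (Sigma.mk.inj_iff.1 h1).1
    refine ⟨Equiv.ofBijective σ (Finite.injective_iff_bijective.1 hinj), ?_⟩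
    ext1 ⟨i, ⟨a, ha⟩⟩
    by_cases hlt : a + 1 < b i
    · rw [joinPaths_of_lt hb _ i a hlt]
      exact (h ⟨i, ⟨a, ha⟩⟩ ⟨i, ⟨a + 1, hlt⟩⟩ ⟨rfl, rfl⟩).symm
    · obtain rfl : a = b i - 1 := by omega
      rw [joinPaths_last, hσ]
      rfl

/-- An invariant colouring is constant along each path, so it is a colouring of the paths, and
invariance at the ends of the paths is invariance under `σ`. -/
theorem sum_comp_joinPaths_eq {N : ℕ} (σ : Equiv.Perm (Fin r)) :
    ∑ g : (Σ i, Fin (b i)) → Fin N with g ∘ joinPaths hb σ = g,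
        ∏ v, (MvPolynomial.X (g v) : MvPolynomial (Fin N) ℂ) =
      ∑ f : Fin r → Fin N with f ∘ σ = f, ∏ s, MvPolynomial.X (f s) ^ b s := by
  classical
  symm
  refine Finset.sum_bij (fun f _ v => f v.1) ?_ ?_ ?_ ?_
  · intro f hf
    rw [Finset.mem_filter] at hf ⊢
    refine ⟨Finset.mem_univ _, ?_⟩
    funext ⟨i, ⟨a, ha⟩⟩
    simp only [Function.comp_apply]
    by_cases hlt : a + 1 < b i
    · rw [joinPaths_of_lt hb _ i a hlt]
    · obtain rfl : a = b i - 1 := by omega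
      rw [joinPaths_last]
      exact congrFun hf.2 i
  · intro f _ f' _ h
    funext i
    exact congrFun h ⟨i, ⟨0, hb i⟩⟩
  · intro g hg
    rw [Finset.mem_filter] at hg
    have hconst : ∀ i a (ha : a < b i), g ⟨i, ⟨a, ha⟩⟩ = g ⟨i, ⟨0, hb i⟩⟩ := by
      intro i a
      induction a with
      | zero => exact fun _ => rfl
      | succ a ih =>
        intro ha
        rw [← ih (by omega), ← joinPaths_of_lt hb σ i a ha]
        exact congrFun hg.2 _
    refine ⟨fun i => g ⟨i, ⟨0, hb i⟩⟩, ?_, ?_⟩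
    · rw [Finset.mem_filter]
      refine ⟨Finset.mem_univ _, ?_⟩
      funext i
      simp only [Function.comp_apply]
      rw [← joinPaths_last, ← hconst i (b i - 1) (Nat.sub_lt (hb i) one_pos)]
      exact congrFun hg.2 _
    · funext ⟨i, ⟨a, ha⟩⟩
      exact (hconst i a ha).symm
  · intro f _
    rw [Fintype.prod_sigma]
    simp

end JoinPaths

theorem sum_indicator_psumPart {n N : ℕ} (α : Composition n) (P : PartialPerm n)
    (e : P.graph.Adj ≃r (pathUnion α).Adj) :
    ∑ w : Equiv.Perm (Fin n), P.indicator w • MvPolynomial.psumPart (Fin N) ℂ w.partition =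
      ∑ f : Fin α.length → Fin N, (∏ i, (Fintype.card {s // f s = i})!) •
        ∏ s, MvPolynomial.X (f s) ^ α.blocksFun s := by
  classical
  have hb : ∀ i, 0 < α.blocksFun i := fun i => α.one_le_blocksFun i
  rw [← sum_perm_eq_sum_factorial]
  obtain ⟨E, hE⟩ : ∃ E : Fin n ≃ Σ i, Fin (α.blocksFun i), ∀ a c,
      (pathUnion α).Adj (E a) (E c) ↔ P.graph.Adj a c := ⟨e.toEquiv, fun _ _ => e.map_rel_iff⟩
  have hext : ∀ w : Equiv.Perm (Fin n), (∀ t, w (P.I t) = P.J t) ↔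
      ∃ σ, joinPaths hb σ = E.permCongr w := by
    intro w
    rw [exists_joinPaths_iff]
    constructor
    · intro h x y hxy
      obtain ⟨a, rfl⟩ := E.surjective x
      obtain ⟨c, rfl⟩ := E.surjective y
      obtain ⟨t, rfl, rfl⟩ := (hE _ _).1 hxy
      rw [← h t]
      simp [Equiv.permCongr_apply]
    · intro h t
      have := h (E (P.I t)) (E (P.J t)) ((hE _ _).2 ⟨t, rfl, rfl⟩)
      simpa [Equiv.permCongr_apply] using this
  have h1 : ∀ w : Equiv.Perm (Fin n),
      P.indicator w • MvPolynomial.psumPart (Fin N) ℂ w.partition =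
        if ∃ σ, joinPaths hb σ = E.permCongr w then
          ∑ g : (Σ i, Fin (α.blocksFun i)) → Fin N with g ∘ E.permCongr w = g,
            ∏ v, MvPolynomial.X (g v) else 0 := by
    intro w
    unfold PartialPerm.indicator
    simp only [hext w]
    split_ifs with h
    · rw [one_smul, psumPart_partition]
      refine Finset.sum_nbij' (fun g v => g (E.symm v)) (fun g a => g (E a)) ?_ ?_ ?_ ?_ ?_
      · intro g hg
        rw [Finset.mem_filter] at hg ⊢
        refine ⟨Finset.mem_univ _, ?_⟩
        funext v
        simpa [Equiv.permCongr_apply] using congrFun hg.2 (E.symm v)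
      · intro g hg
        rw [Finset.mem_filter] at hg ⊢
        refine ⟨Finset.mem_univ _, ?_⟩
        funext a
        simpa [Equiv.permCongr_apply] using congrFun hg.2 (E a)
      · intro g _
        simp
      · intro g _
        simp
      · intro g _
        exact (Equiv.prod_comp E.symm fun a => MvPolynomial.X (g a)).symm
    · rw [zero_smul]
  simp only [h1]
  rw [Equiv.sum_comp E.permCongr fun w => if ∃ σ, joinPaths hb σ = w then
    ∑ g : (Σ i, Fin (α.blocksFun i)) → Fin N with g ∘ w = g,
      ∏ v, (MvPolynomial.X (g v) : MvPolynomial (Fin N) ℂ) else 0, ← Finset.sum_filter]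
  symm
  refine Finset.sum_bij (fun σ _ => joinPaths hb σ) ?_ ?_ ?_ ?_
  · exact fun σ _ => Finset.mem_filter.2 ⟨Finset.mem_univ _, σ, rfl⟩
  · exact fun σ _ τ _ h => joinPaths_injective hb h
  · intro w hw
    obtain ⟨σ, hσ⟩ := (Finset.mem_filter.1 hw).2
    exact ⟨σ, Finset.mem_univ _, hσ⟩
  · exact fun σ _ => (sum_comp_joinPaths_eq hb σ).symm

/-! ### Counting labels -/

theorem exists_labels {ι : Type*} [Fintype ι] [DecidableEq ι] (b : ι → ℕ) (τ : List ℕ)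
    (h : (τ : Multiset ℕ) = Finset.univ.val.map b) :
    ∃ l : List ι, l.Nodup ∧ (∀ s, s ∈ l) ∧ l.map b = τ := by
  have hperm : τ.Perm ((Finset.univ : Finset ι).toList.map b) := by
    rw [← Multiset.coe_eq_coe, h, ← Multiset.map_coe, Finset.coe_toList]
  have hF : List.Forall₂ (fun d s => d = b s) ((Finset.univ : Finset ι).toList.map b)
      (Finset.univ : Finset ι).toList := by
    rw [List.forall₂_map_left_iff, List.forall₂_same]
    exact fun _ _ => rfl
  obtain ⟨l, hl, hp⟩ := List.perm_comp_forall₂ hperm hF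
  refine ⟨l, hp.nodup_iff.2 (Finset.nodup_toList _), fun s => hp.mem_iff.2 (by simp), ?_⟩
  rw [← List.forall₂_map_right_iff (R := fun d e : ℕ => d = e), List.forall₂_eq_eq_eq] at hl
  exact hl.symm

theorem exists_perm_map_eq {ι : Type*} [Fintype ι] [DecidableEq ι] {l l' : List ι}
    (hl : l.Nodup) (hl' : l'.Nodup) (h : ∀ s, s ∈ l) (h' : ∀ s, s ∈ l') :
    ∃ σ : Equiv.Perm ι, l.map σ = l' := by
  let E := hl.getEquivOfForallMemList l h
  let E' := hl'.getEquivOfForallMemList l' h'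
  have hlen : l.length = l'.length := by
    simpa using Fintype.card_congr (E.trans E'.symm)
  refine ⟨E.symm.trans ((finCongr hlen).trans E'), ?_⟩
  refine List.ext_getElem (by simpa using hlen) fun i h1 h2 => ?_
  have hi : i < l.length := by simpa using h1
  have : l[i] = E ⟨i, hi⟩ := rfl
  rw [List.getElem_map, this]
  simp [E']

/-- The complete labellings of a tiling compatible with its type form one free orbit of the
permutations `σ` with `b ∘ σ = b`. These permute the labels of equal size, so there are `m(μ)!` of
them; `lab` picks a base point of each orbit. -/
theorem sum_labelledTiling {M : Type*} [AddCommMonoid M] {n : ℕ} (μ : n.Partition)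
    {ι : Type*} [Fintype ι] [DecidableEq ι] (b : ι → ℕ)
    (hμ : Finset.univ.val.map b = μ.parts) (F : MonotonicTiling → M) :
    ∑ p : LabelledTiling b with p.free = ∅, F p.tiling =
      multFactorial μ • ∑ T : TilingsOfType μ, F T.1 := by
  classical
  have hcard : (Finset.univ.filter fun σ : Equiv.Perm ι => b ∘ σ = b).card =
      multFactorial μ := by
    have h1 := DomMulAct.stabilizer_card' b
    rw [Fintype.card_subtype] at h1
    rw [h1, multFactorial, ← hμ]
    refine Finset.prod_congr ?_ fun d _ => ?_
    · rw [Finset.image]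
    · rw [Multiset.count_map, Fintype.card_subtype]
      simp only [eq_comm]
      rfl
  have hfree : ∀ p : LabelledTiling b, p.free = ∅ ↔ ∀ s, s ∈ p.labels := by
    intro p
    rw [LabelledTiling.free, Finset.compl_eq_empty_iff, Finset.eq_univ_iff_forall]
    simp
  choose lab hnd hall hmap using fun T : TilingsOfType μ =>
    exists_labels b T.1.type (T.2.trans hμ.symm)
  rw [Finset.smul_sum]
  have h2 : ∀ T : TilingsOfType μ, multFactorial μ • F T.1 =
      ∑ σ ∈ Finset.univ.filter fun σ : Equiv.Perm ι => b ∘ σ = b, F T.1 := by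
    intro T
    rw [Finset.sum_const, hcard]
  simp only [h2]
  rw [Finset.sum_sigma']
  symm
  have hval : ∀ (T : TilingsOfType μ) (σ : Equiv.Perm ι), b ∘ σ = b →
      ((lab T).map σ).Nodup ∧ ((lab T).map σ).map b = T.1.type := by
    intro T σ hσ
    refine ⟨(hnd T).map σ.injective, ?_⟩
    rw [List.map_map, hσ, hmap]
  refine Finset.sum_bij (fun x hx => (⟨(x.1.1, (lab x.1).map x.2), hval x.1 x.2
    (Finset.mem_filter.1 (Finset.mem_sigma.1 hx).2).2⟩ : LabelledTiling b)) ?_ ?_ ?_ ?_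
  · rintro ⟨T, σ⟩ hx
    refine Finset.mem_filter.2 ⟨Finset.mem_univ _, (hfree _).2 fun s => ?_⟩
    change s ∈ (lab T).map σ
    exact List.mem_map.2 ⟨σ.symm s, hall T _, by simp⟩
  · rintro ⟨T, σ⟩ hx ⟨T', σ'⟩ hx' h
    have h1 := congrArg Subtype.val h
    simp only [Prod.mk.injEq] at h1
    obtain rfl : T = T' := Subtype.ext h1.1
    have h3 := List.map_inj_left.1 h1.2
    obtain rfl : σ = σ' := Equiv.ext fun s => h3 s (hall T s)
    rfl
  · intro p hp
    rw [Finset.mem_filter, hfree] at hp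
    have htype : (p.tiling.type : Multiset ℕ) = μ.parts := by
      rw [← hμ, ← p.map_labels, ← Multiset.map_coe]
      congr 1
      refine (Multiset.Nodup.ext (Multiset.coe_nodup.2 p.nodup) Finset.univ.nodup).2 fun s => ?_
      simpa using hp.2 s
    let T : TilingsOfType μ := ⟨p.tiling, htype⟩
    obtain ⟨σ, hσ⟩ := exists_perm_map_eq (hnd T) p.nodup (hall T) hp.2
    have hbσ : b ∘ σ = b := by
      have h1 : ((lab T).map σ).map b = (lab T).map b := by
        rw [hσ, hmap, p.map_labels]
      rw [List.map_map] at h1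
      exact funext fun s => List.map_inj_left.1 h1 s (hall T s)
    refine ⟨⟨T, σ⟩, ?_, LabelledTiling.ext rfl hσ⟩
    rw [Finset.mem_sigma, Finset.mem_filter]
    exact ⟨Finset.mem_univ _, Finset.mem_univ _, hbσ⟩
  · intro x hx
    rfl

theorem sum_indicator_psumPart_eq {n N : ℕ} (hN : n ≤ N) (μ : n.Partition) (P : PartialPerm n)
    (e : P.graph.Adj ≃r (pathUnion (sortedParts μ)).Adj) :
    ∑ w : Equiv.Perm (Fin n), P.indicator w • MvPolynomial.psumPart (Fin N) ℂ w.partition =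
      multFactorial μ • ∑ T : TilingsOfType μ, T.1.sign • schurPoly N T.1.shape := by
  classical
  -- After multiplication by `ε · x^δ`, both sides become the same sum of alternants over tilings.
  refine mul_left_cancel₀ (alternant_zero_ne_zero N) ?_
  have hsum : ∑ s, (sortedParts μ).blocksFun s ≤ N := by
    rw [Composition.sum_blocksFun]
    exact hN
  have hparts : Finset.univ.val.map (sortedParts μ).blocksFun = μ.parts := by
    rw [Fin.univ_val_map, Composition.ofFn_blocksFun]
    exact Multiset.sort_eq _ _
  rw [sum_indicator_psumPart _ P e, alternant_zero_mul_sum,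
    fillingSum_univ_eq_sum_tilings (fun s => (sortedParts μ).one_le_blocksFun s) hsum,
    sum_labelledTiling μ _ hparts fun T => T.sign • alternant N fun i => T.shape.rowLen i,
    mul_smul_comm, Finset.mul_sum]
  simp only [mul_smul_comm, schurPoly_spec]

end
end PathMN

theorem theorem4 (n : ℕ) (μ : n.Partition) :
    PathMN.pathPowerSum (PathMN.sortedParts μ) =
      PathMN.multFactorial μ •
        ∑ T : PathMN.TilingsOfType μ, T.1.sign • PathMN.schur T.1.shape := by
  obtain ⟨e⟩ := Classical.choose_spec (PathMN.exists_partialPerm (PathMN.sortedParts μ))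
  rw [PathMN.pathPowerSum, PathMN.atomic_eq_sum]
  ext m
  -- `N` must exceed every variable index in the monomial `m`, for truncation, and be at least `n`,
  -- so that all shapes fit into `N` rows.
  obtain ⟨N, hnN, hN⟩ : ∃ N, n ≤ N ∧ ∀ i, N ≤ i → m i = 0 := by
    refine ⟨max n (m.support.sup id + 1), le_max_left _ _, fun i hi => ?_⟩
    by_contra hne
    have := Finset.le_sup (f := id) (Finsupp.mem_support_iff.2 hne)
    simp only [id_eq] at this
    omega
  have hL : PathMN.AgreeBelow N _ _ := PathMN.AgreeBelow.sum Finset.univ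
    fun (w : Equiv.Perm (Fin n)) _ => (PathMN.AgreeBelow.powerSumPart (N := N) w.partition).smul
      ((Classical.choose (PathMN.exists_partialPerm (PathMN.sortedParts μ))).indicator w)
  have hshape : ∀ T : PathMN.TilingsOfType μ, T.1.shape.colLen 0 ≤ N := by
    intro T
    have h1 : T.1.shape.card ≤ n := by
      refine T.1.card_shape_le.trans ?_
      rw [← Multiset.sum_coe, T.2, μ.parts_sum]
    by_contra! hlt
    have h2 := (PathMN.lt_card_of_mem T.1.shape (N, 0) (YoungDiagram.mem_iff_lt_colLen.2 hlt)).1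
    simp only at h2
    omega
  have hR : PathMN.AgreeBelow N _ _ := (PathMN.AgreeBelow.sum Finset.univ
    fun (T : PathMN.TilingsOfType μ) _ =>
      (PathMN.AgreeBelow.schur T.1.shape (hshape T)).zsmul T.1.sign).nsmul (PathMN.multFactorial μ)
  rw [hL m hN, hR m hN, PathMN.sum_indicator_psumPart_eq hnN μ _ e]
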